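/- **Setting.** Let $\mathcal X$ be a set with a hierarchical binary partition: $\mathcal P_{0,1}=\mathcal X$, every cell $\mathcal P_{h,i}$ ($h\ge 0$, $1\le i\le 2^h$) is the disjoint union of its children $\mathcal P_{h+1,2i-1}$ and $\mathcal P_{h+1,2i}$, and every cell has a representative arm $x_{h,i}\in\mathcal P_{h,i}$. Let $f:\mathcal X\to[0,1]$, $f^*=\sup f$. Pulling an arm $x$ gives a reward in $[0,1]$ with a law $\nu_x$ of mean $f(x)$ that is supported in $[f(x)-\frac b2,f(x)+\frac b2]$; the successive rewards $r^1(x_{h,i}),r^2(x_{h,i}),\dots$ of the nodes are i.i.d. with law $\nu_{x_{h,i}}$, independent over the nodes. Put $\phi(h)=1/h$ for $h\ge1$ and assume: * (local smoothness) there is a maximizer $x^*$ of $f$ such that $f(x_{h,i})\ge f^*-1/h$ whenever $h\ge 1$ and $x^*\in\mathcal P_{h,i}$; * (near-optimality dimension) $d(3,C,1/h)<\bar d$, where $d(a,C,\xi)$ is the infimum of all $d'\ge0$ such that for all $h\ge1$ at most $C\,\xi(h)^{-d'}$ indices $i$ satisfy $f(x_{h,i})\ge f^*-a\,\xi(h)$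 (and $d(a,C,\xi)=\infty$ if there is no such $d'$); * (node variances) $\epsilon\le \mathrm{Var}(\nu_{x_{h,i}})\le V_{\max}$ for all nodes, with a fixed $\epsilon>0$. **The algorithm VHCT** (confidence parameter $\delta\in(0,1]$). Let $t^+=2^{\lfloor\log_2 t\rfloor+1}$, $c=3$, $\tilde\delta(t)=\delta/(3t)$. For a node that has been pulled $T$ times, with empirical mean $\widehat\mu$ and empirical variance $\widehat{\mathbb V}$ (normalized by $T$), put $$\mathtt{SE}=c\sqrt{\tfrac{2\widehat{\mathbb V}\log(1/\tilde\delta(t^+))}{T}}+\tfrac{3bc^2\log(1/\tilde\delta(t^+))}{T},\qquad U=\widehat\mu+\phi(h)+\mathtt{SE}\quad(U=+\infty\text{ if }T=0),$$ and let $\tau$ be the value of $T$ that solves $\mathtt{SE}=\phi(h)$. Let $B=U$ at the leaves of the current tree and $B=\min\{U,\max\text{ of }B\text{ over the two children}\}$ at the other nodes. The tree starts with the root and its two children. In each round $t=1,\dots,n$, start at the root, move to the child with the larger $B$ (ties are settled by any fixed rule), and continue until the current node is a leaf or has $T<\tau$; pull this node, receive $r_t$; if it is a leaf and now $T\ge\tau$,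 with both updated, add its two children to the tree. Let $R_n=\sum_{t=1}^n(f^*-r_t)$. **Theorem.** For all $C,b,\bar d>0$ there is a constant $C_1>0$, and for every $\epsilon>0$ a constant $C_2>0$, such that in every setting as above, with these $C,b,\bar d,\epsilon$, for all $n\ge1$ and $\delta\in(0,1]$, with probability at least $1-\frac{\delta}{4n^2}-\frac{\delta}{6n^3}$ (in particular at least $1-\delta$), $$R_n\le 2\sqrt{2n\log\tfrac{4n^2}{\delta}}+C_1V_{\max}^{\frac1{4\bar d+6}}n^{\frac{2\bar d+2}{2\bar d+3}}\Big(\log\frac n\delta\Big)^{\frac1{2\bar d+3}}+C_2\,n^{\frac{2\bar d+1}{2\bar d+3}}\log\frac n\delta .$$ Moreover, with the same $C_1,C_2$, for all $n\ge1$ and for VHCT run with $\delta=1/n$, the regret $R_n$ is integrable and $$\mathbb E[R_n]\le 2\sqrt{2n\log(4n^3)}+C_1V_{\max}^{\frac1{4\bar d+6}}n^{\frac{2\bar d+2}{2\bar d+3}}\big(\log n^2\big)^{\frac1{2\bar d+3}}+C_2\,n^{\frac{2\bar d+1}{2\bar d+3}}\log n^2 .$$ -/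

import Mathlib

open MeasureTheory ProbabilityTheory
open scoped ENNReal NNReal

namespace VHCT

/-- Nodes of the infinite binary tree. A node at depth `h` is a binary word of length `h`
(equivalently, a pair of a depth `h` and one of `2 ^ h` indices); the root is the empty word and
the two children of `v` are `false :: v` and `true :: v`. -/
abbrev Node : Type := List Bool

/-- A hierarchical binary partition of the arm space: the root cell is the whole space, every
cell is the disjoint union of the cells of its two children, and every cell has a
representative arm, the one that is evaluated when the node is pulled. -/
structure HPartition (X : Type*) where
  cell : Node → Set X
  arm : Node → X
  cell_root : cell [] = Set.univ
  cell_split : ∀ v, cell v = cell (false :: v) ∪ cell (true :: v)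
  cell_disjoint : ∀ v, Disjoint (cell (false :: v)) (cell (true :: v))
  arm_mem : ∀ v, arm v ∈ cell v

/-- Local smoothness with rate `φ`: some global maximizer `xs` of `f` exists such that the
representative of the depth-`h` cell containing `xs` is `φ h`-optimal, for every `h ≥ 1`. -/
def LocallySmooth {X : Type*} (P : HPartition X) (f : X → ℝ) (φ : ℕ → ℝ) : Prop :=
  ∃ xs : X, (∀ z, f z ≤ f xs) ∧
    ∀ v : Node, 1 ≤ v.length → xs ∈ P.cell v → f xs - φ v.length ≤ f (P.arm v)

/-- The number of nodes at depth `h` whose representative is `η`-optimal. -/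
noncomputable def nearOptCount {X : Type*} (P : HPartition X) (f : X → ℝ) (h : ℕ) (η : ℝ) : ℕ :=
  Set.ncard {v : Node | v.length = h ∧ (⨆ z, f z) - η ≤ f (P.arm v)}

/-- The near-optimality dimension `d(a, C, ξ)`: the infimum of the `d ≥ 0` such that there are at
most `C * ξ(h) ^ (-d)` nodes at depth `h` that are `a * ξ(h)`-optimal, for all depths `h ≥ 1`;
it is `∞` if there is no such `d`. -/
noncomputable def nearOptDim {X : Type*} (P : HPartition X) (f : X → ℝ)
    (a C : ℝ) (ξ : ℕ → ℝ) : ℝ≥0∞ :=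
  ⨅ d ∈ {d : ℝ≥0 | ∀ h : ℕ, 1 ≤ h →
    (nearOptCount P f h (a * ξ h) : ℝ) ≤ C * ξ h ^ (-(d : ℝ))}, (d : ℝ≥0∞)

/-- Stochastic rewards `r = f(x) + noise`: pulling the arm `x` gives a reward with law `ν x`,
with values in `[0, 1]`, with mean `f x`, and with noise bounded by `b / 2`. -/
structure IsRewardModel {X : Type*} (f : X → ℝ) (b : ℝ) (ν : X → Measure ℝ) : Prop where
  prob : ∀ x, IsProbabilityMeasure (ν x)
  reward_mem : ∀ x, ∀ᵐ r ∂ν x, r ∈ Set.Icc (0 : ℝ) 1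
  noise_le : ∀ x, ∀ᵐ r ∂ν x, |r - f x| ≤ b / 2
  mean_eq : ∀ x, ∫ r, r ∂ν x = f x

/-- `Y v s` is the reward obtained at the pull number `s + 1` of the node `v`. All these rewards
are independent, and `Y v s` has the reward law of the representative of `v`. -/
structure IsRewardSample {X Ω : Type*} [MeasurableSpace Ω] (P : HPartition X)
    (ν : X → Measure ℝ) (Y : Node → ℕ → Ω → ℝ) (μ : Measure Ω) : Prop where
  measurable : ∀ v s, Measurable (Y v s)
  law : ∀ v s, HasLaw (Y v s) (ν (P.arm v)) μ
  indep : iIndepFun (fun p : Node × ℕ => Y p.1 p.2) μ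

/-- `t⁺ = 2 ^ (⌊log₂ t⌋ + 1)`. -/
def tPlus (t : ℕ) : ℕ := 2 ^ (Nat.log 2 t + 1)

/-- `log (1 / δ̃(t⁺))` with `δ̃(t) = δ / (3 t)`. -/
noncomputable def logTerm (δ : ℝ) (t : ℕ) : ℝ :=
  Real.log (1 / (δ / (3 * (tPlus t : ℝ))))

/-- Empirical mean of the first `T` rewards of a node. -/
noncomputable def empMean (y : ℕ → ℝ) (T : ℕ) : ℝ :=
  (∑ s ∈ Finset.range T, y s) / T

/-- Empirical variance of the first `T` rewards of a node. -/
noncomputable def empVar (y : ℕ → ℝ) (T : ℕ) : ℝ :=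
  (∑ s ∈ Finset.range T, (y s - empMean y T) ^ 2) / T

/-- Statistical error `SE` of a node with `T` pulls and empirical variance `V`, where `L` is the
logarithmic term and where `c = 3`. -/
noncomputable def statErr (b L V T : ℝ) : ℝ :=
  3 * √(2 * V * L / T) + 3 * b * 3 ^ 2 * L / T

/-- The threshold `τ`, the value of `T` at which `statErr b L V T = p`, where `c = 3` and where `p`
is the value of the smoothness function at the depth of the node. -/
noncomputable def threshold (b L V p : ℝ) : ℝ :=
  (V + √(V ^ 2 + 6 * b * p * V) + 3 * b * p) * (3 ^ 2 * L / p ^ 2)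

/-- What the algorithm stores between rounds: the current tree and the numbers of pulls. -/
structure State where
  tree : Finset Node
  pulls : Node → ℕ

/-- The initial tree consists of the root and its two children. -/
def State.init : State where
  tree := {[], [false], [true]}
  pulls := fun _ => 0

/-- A node of the tree is a leaf if its children are not in the tree
(children are always added in pairs). -/
def State.IsLeaf (σ : State) (v : Node) : Prop := false :: v ∉ σ.tree ∧ true :: v ∉ σ.tree

/-- The depth of the tree. -/
def State.depth (σ : State) : ℕ := σ.tree.sup List.length

/-- The data of a run of the algorithm: the smoothness function, the noise bound, the confidence
parameter, and a rule that settles ties in the choice of a child (`tie t v` is taken if the two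
children of `v` have equal `B`-values in round `t`). -/
structure Params where
  φ : ℕ → ℝ
  b : ℝ
  δ : ℝ
  tie : ℕ → Node → Bool

/-- The threshold `τ_v(t)` in the state `σ`, where `y v s` is the reward number `s + 1` of `v`. -/
noncomputable def tau (A : Params) (y : Node → ℕ → ℝ) (t : ℕ) (σ : State) (v : Node) : ℝ :=
  threshold A.b (logTerm A.δ t) (empVar (y v) (σ.pulls v)) (A.φ v.length)

/-- The value `U_v(t)`; it is `+∞` for a node that has not been pulled. -/
noncomputable def uVal (A : Params) (y : Node → ℕ → ℝ) (t : ℕ) (σ : State) (v : Node) : EReal :=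
  if σ.pulls v = 0 then ⊤
  else ((empMean (y v) (σ.pulls v) + A.φ v.length +
    statErr A.b (logTerm A.δ t) (empVar (y v) (σ.pulls v)) (σ.pulls v) : ℝ) : EReal)

open Classical in
/-- Backward recursion for the `B`-values: `B = U` at a leaf, and otherwise
`B = min {U, max of B over the two children}`. The first argument bounds the number of recursive
calls. -/
noncomputable def bAux (A : Params) (y : Node → ℕ → ℝ) (t : ℕ) (σ : State) : ℕ → Node → EReal
  | 0, v => uVal A y t σ v
  | k + 1, v =>
    if σ.IsLeaf v then uVal A y t σ v
    else min (uVal A y t σ v)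
      (max (bAux A y t σ k (false :: v)) (bAux A y t σ k (true :: v)))

/-- The value `B_v(t)`; nodes at the depth of the tree are leaves, so that the recursion
always ends at leaves. -/
noncomputable def bVal (A : Params) (y : Node → ℕ → ℝ) (t : ℕ) (σ : State) (v : Node) : EReal :=
  bAux A y t σ (σ.depth - v.length) v

open Classical in
/-- The child with the larger `B`-value. -/
noncomputable def bestChild (A : Params) (y : Node → ℕ → ℝ) (t : ℕ) (σ : State) (v : Node) :
    Node :=
  if bVal A y t σ (true :: v) < bVal A y t σ (false :: v) then false :: v
  else if bVal A y t σ (false :: v) < bVal A y t σ (true :: v) then true :: v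
  else A.tie t v :: v

open Classical in
/-- The traversal: as long as the node is not a leaf and has been pulled at least `τ` times, move
to the child with the larger `B`-value. The root always counts as pulled often enough. -/
noncomputable def descend (A : Params) (y : Node → ℕ → ℝ) (t : ℕ) (σ : State) : ℕ → Node → Node
  | 0, v => v
  | k + 1, v =>
    if ¬ σ.IsLeaf v ∧ (v = [] ∨ tau A y t σ v ≤ σ.pulls v) then
      descend A y t σ k (bestChild A y t σ v)
    else v

/-- The node pulled in round `t`, where `σ` is the state after round `t - 1`. -/
noncomputable def select (A : Params) (y : Node → ℕ → ℝ) (t : ℕ) (σ : State) : Node :=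
  descend A y t σ σ.depth []

/-- The number of pulls of `v` goes up by one. -/
def State.pull (σ : State) (v : Node) : State where
  tree := σ.tree
  pulls := Function.update σ.pulls v (σ.pulls v + 1)

/-- The two children of `v` are added to the tree. -/
def State.expand (σ : State) (v : Node) : State where
  tree := σ.tree ∪ {false :: v, true :: v}
  pulls := σ.pulls

open Classical in
/-- Round `t`: select and pull a node `v`; if `v` is a leaf and its updated number of pulls has
reached its updated threshold, then expand `v`. -/
noncomputable def step (A : Params) (y : Node → ℕ → ℝ) (t : ℕ) (σ : State) : State :=
  let v := select A y t σ
  let σ' := σ.pull v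
  if σ'.IsLeaf v ∧ tau A y t σ' v ≤ σ'.pulls v then σ'.expand v else σ'

/-- The state after `t` rounds. -/
noncomputable def state (A : Params) (y : Node → ℕ → ℝ) : ℕ → State
  | 0 => State.init
  | t + 1 => step A y (t + 1) (state A y t)

/-- The reward received in round `t ≥ 1`. -/
noncomputable def reward (A : Params) (y : Node → ℕ → ℝ) (t : ℕ) : ℝ :=
  let σ := state A y (t - 1)
  let v := select A y t σ
  y v (σ.pulls v)

/-- The cumulative regret `R_n`, the sum of `f* - r_t` over the rounds `t = 1, …, n`. -/
noncomputable def regret {X : Type*} (f : X → ℝ) (A : Params) (y : Node → ℕ → ℝ) (n : ℕ) : ℝ :=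
  ∑ t ∈ Finset.Icc 1 n, ((⨆ z, f z) - reward A y t)

/-- The right-hand side of the regret bound. -/
noncomputable def regretBound (C₁ C₂ d V : ℝ) (n : ℕ) (δ : ℝ) : ℝ :=
  2 * √(2 * n * Real.log (4 * (n : ℝ) ^ 2 / δ))
    + C₁ * V ^ (1 / (4 * d + 6)) * (n : ℝ) ^ ((2 * d + 2) / (2 * d + 3))
        * Real.log (n / δ) ^ (1 / (2 * d + 3))
    + C₂ * (n : ℝ) ^ ((2 * d + 1) / (2 * d + 3)) * Real.log (n / δ)

end VHCT

namespace VHCT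

/-! The proof is an optimism argument followed by a count of the nodes that are pulled. Suppose that
all confidence bounds hold. A node whose cell contains the maximizer `xs` has `U ≥ f*` by local
smoothness, and this passes up to the `B`-values, so the traversal only visits nodes with `B ≥ f*`
below the root (`pulled_spec`). Such a node satisfies `f* - f ≤ φ + 2 SE` if it has been pulled. If
it is pulled again, it has not reached its threshold, so `φ < SE` and its gap is below `3 SE`, of
order `√(log / T)`. Its parent, if not the root, has reached its threshold, so `SE ≤ φ` there and
the parent is `3φ`-optimal (`round_bound`).

The near-optimality dimension thus bounds the number of parents above a depth `H` by a multiple of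
`H ^ (d + 1)`. A parent at depth at least `H` has an empirical variance of at least `ε / 2`, so its
threshold is at least of order `ε ℓ H ^ 2`, where `ℓ = log (n / δ)`; since all pulls add up to at
most `n`, there are few such parents (`card_le_of_parents`). Summing the gaps gives `ℓ H ^ (d + 2) +
n / H` up to constants (`sum_gap_le`). The best `H` yields `n (ℓ / n) ^ (1 / (d + 3))`, of strictly
smaller order than the target `n (ℓ / n) ^ (1 / (2 d + 3))` because `d > 0`. The surplus power of `ℓ
/ n` absorbs every constant when `ℓ / n` is small; otherwise the `C₂` term exceeds the trivial bound
`n` (`exists_depth`). This is why `C₁ = 1` suffices.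

Probability enters twice. Confidence comes from an empirical Bernstein inequality
(`measureReal_not_confAt_le`); the tree is infinite, so the union runs over the rounds in which a
node is first pulled, its rewards being then independent of the past (`measure_exists_pulled_le`).
The deviation of the received rewards from their means is controlled by Azuma-Hoeffding
(`measure_sum_sub_received_ge_le`). Both rest on `lintegral_pulled_le`. The confidence level of the
early rounds is too weak, so the rounds before `√n` are bounded trivially. One copy of `√(2 n log (4
n² / δ))` pays for the martingale part; the other pays for the early rounds and leaves a margin `1 /
2`, which covers the bad event in the bound on the expectation. -/

/-! ### The run of the algorithm -/

/-- The node pulled in round `t + 1`. -/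
noncomputable def pulled (A : Params) (y : Node → ℕ → ℝ) (t : ℕ) : Node :=
  select A y (t + 1) (state A y t)

/-- The number of pulls, before round `t + 1`, of the node pulled in that round. -/
noncomputable def pullIdx (A : Params) (y : Node → ℕ → ℝ) (t : ℕ) : ℕ :=
  (state A y t).pulls (pulled A y t)

lemma step_pulls (A : Params) (y : Node → ℕ → ℝ) (t : ℕ) (σ : State) :
    (step A y t σ).pulls =
      Function.update σ.pulls (select A y t σ) (σ.pulls (select A y t σ) + 1) := by
  simp only [step]
  split_ifs <;> rfl

lemma subset_step_tree (A : Params) (y : Node → ℕ → ℝ) (t : ℕ) (σ : State) :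
    σ.tree ⊆ (step A y t σ).tree := by
  simp only [step]
  split_ifs
  · exact Finset.subset_union_left
  · exact subset_rfl

lemma state_succ_pulls (A : Params) (y : Node → ℕ → ℝ) (t : ℕ) :
    (state A y (t + 1)).pulls =
      Function.update (state A y t).pulls (pulled A y t) (pullIdx A y t + 1) :=
  step_pulls A y (t + 1) _

lemma state_pulls_mono (A : Params) (y : Node → ℕ → ℝ) (v : Node) :
    Monotone fun t => (state A y t).pulls v := by
  refine monotone_nat_of_le_succ fun t => ?_
  rw [state_succ_pulls]
  by_cases h : v = pulled A y t
  · subst h; simp [pullIdx]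
  · simp [Function.update_of_ne h]

lemma singleton_false_mem_tree (A : Params) (y : Node → ℕ → ℝ) (t : ℕ) :
    [false] ∈ (state A y t).tree := by
  induction t with
  | zero => simp [state, State.init]
  | succ t ih => exact subset_step_tree A y (t + 1) _ ih

lemma sum_pulls_le (A : Params) (y : Node → ℕ → ℝ) (t : ℕ) (F : Finset Node) :
    ∑ v ∈ F, (state A y t).pulls v ≤ t := by
  induction t with
  | zero => simp [state, State.init]
  | succ t ih =>
    rw [state_succ_pulls]
    by_cases h : pulled A y t ∈ F
    · rw [Finset.sum_update_of_mem h]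
      rw [← Finset.add_sum_erase _ _ h, Finset.erase_eq] at ih
      simp only [pullIdx] at *
      omega
    · rw [Finset.sum_update_of_notMem h]
      omega

lemma pulls_le (A : Params) (y : Node → ℕ → ℝ) (t : ℕ) (v : Node) :
    (state A y t).pulls v ≤ t := by
  simpa using sum_pulls_le A y t {v}

lemma pullIdx_lt_pulls (A : Params) (y : Node → ℕ → ℝ) {t n : ℕ} (h : t < n) :
    pullIdx A y t < (state A y n).pulls (pulled A y t) := by
  have h1 := state_pulls_mono A y (pulled A y t) (Nat.succ_le_of_lt h)
  simp only [Nat.succ_eq_add_one, state_succ_pulls, Function.update_self] at h1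
  omega

/-- A round is determined by the node pulled and the number of its previous pulls. -/
lemma pulled_pullIdx_injective (A : Params) (y : Node → ℕ → ℝ) :
    Function.Injective fun t => (pulled A y t, pullIdx A y t) := by
  have key : ∀ s t, s < t → (pulled A y s, pullIdx A y s) ≠ (pulled A y t, pullIdx A y t) := by
    intro s t hst h
    simp only [Prod.mk.injEq] at h
    have h1 := pullIdx_lt_pulls A y hst
    rw [h.1, h.2] at h1
    exact lt_irrefl _ h1
  intro s t h
  rcases lt_trichotomy s t with hst | hst | hst
  · exact absurd h (key s t hst)
  · exact hst
  · exact absurd h.symm (key t s hst)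

/-- A node that has been pulled has had a first pull. -/
lemma exists_first_pull (A : Params) (y : Node → ℕ → ℝ) (n : ℕ) (v : Node)
    (h : 0 < (state A y n).pulls v) : ∃ t < n, pulled A y t = v ∧ pullIdx A y t = 0 := by
  induction n with
  | zero => simp [state, State.init] at h
  | succ n ih =>
    by_cases h0 : 0 < (state A y n).pulls v
    · obtain ⟨t, ht, h1⟩ := ih h0
      exact ⟨t, by omega, h1⟩
    · rw [state_succ_pulls] at h
      by_cases hv : v = pulled A y n
      · refine ⟨n, by omega, hv.symm, ?_⟩
        rw [pullIdx, ← hv]; omega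
      · rw [Function.update_of_ne hv] at h
        exact absurd h h0

lemma length_lt_depth {σ : State} {v : Node} (h : ¬ σ.IsLeaf v) : v.length < σ.depth := by
  have : ∃ c : Bool, c :: v ∈ σ.tree := by
    by_contra hc
    push Not at hc
    exact h ⟨hc false, hc true⟩
  obtain ⟨c, hc⟩ := this
  have := Finset.le_sup (f := List.length) hc
  simpa [State.depth, Nat.succ_le_iff] using this

lemma bVal_of_isLeaf (A : Params) (y : Node → ℕ → ℝ) (t : ℕ) {σ : State} {v : Node}
    (h : σ.IsLeaf v) : bVal A y t σ v = uVal A y t σ v := by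
  unfold bVal
  cases σ.depth - v.length with
  | zero => rfl
  | succ k => simp [bAux, h]

lemma bVal_of_not_isLeaf (A : Params) (y : Node → ℕ → ℝ) (t : ℕ) {σ : State} {v : Node}
    (h : ¬ σ.IsLeaf v) : bVal A y t σ v = min (uVal A y t σ v)
      (max (bVal A y t σ (false :: v)) (bVal A y t σ (true :: v))) := by
  have h1 := length_lt_depth h
  obtain ⟨k, hk⟩ : ∃ k, σ.depth - v.length = k + 1 := ⟨σ.depth - v.length - 1, by omega⟩
  have h2 : σ.depth - (v.length + 1) = k := by omega
  simp only [bVal, hk, bAux, h, if_false, List.length_cons, h2]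

lemma bVal_le_uVal (A : Params) (y : Node → ℕ → ℝ) (t : ℕ) (σ : State) (v : Node) :
    bVal A y t σ v ≤ uVal A y t σ v := by
  by_cases h : σ.IsLeaf v
  · exact (bVal_of_isLeaf A y t h).le
  · rw [bVal_of_not_isLeaf A y t h]; exact min_le_left _ _

lemma bestChild_eq_cons (A : Params) (y : Node → ℕ → ℝ) (t : ℕ) (σ : State) (v : Node) :
    ∃ c, bestChild A y t σ v = c :: v := by
  unfold bestChild
  split_ifs
  exacts [⟨_, rfl⟩, ⟨_, rfl⟩, ⟨_, rfl⟩]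

lemma bVal_bestChild (A : Params) (y : Node → ℕ → ℝ) (t : ℕ) (σ : State) (v : Node) :
    bVal A y t σ (bestChild A y t σ v) =
      max (bVal A y t σ (false :: v)) (bVal A y t σ (true :: v)) := by
  unfold bestChild
  split_ifs with h1 h2
  · exact (max_eq_left h1.le).symm
  · exact (max_eq_right h2.le).symm
  · have : bVal A y t σ (false :: v) = bVal A y t σ (true :: v) :=
      le_antisymm (not_lt.1 h1) (not_lt.1 h2)
    cases A.tie t v <;> simp [this]

/-- Induction principle for the traversal. -/
lemma descend_spec (A : Params) (y : Node → ℕ → ℝ) (t : ℕ) (σ : State) {Q : Node → Prop}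
    (hQ : ∀ v, Q v → ¬ σ.IsLeaf v → (v = [] ∨ tau A y t σ v ≤ σ.pulls v) →
      Q (bestChild A y t σ v)) (k : ℕ) (v : Node) (hv : Q v) (hk : σ.depth ≤ v.length + k) :
    Q (descend A y t σ k v) ∧ (σ.IsLeaf (descend A y t σ k v) ∨
      ¬ (descend A y t σ k v = [] ∨
        tau A y t σ (descend A y t σ k v) ≤ σ.pulls (descend A y t σ k v))) := by
  induction k generalizing v with
  | zero =>
    refine ⟨hv, Or.inl ?_⟩
    by_contra h
    have := length_lt_depth h
    simp only [descend] at this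
    omega
  | succ k ih =>
    unfold descend
    split_ifs with h
    · refine ih _ (hQ v hv h.1 h.2) ?_
      obtain ⟨c, hc⟩ := bestChild_eq_cons A y t σ v
      rw [hc, List.length_cons]; omega
    · exact ⟨hv, by tauto⟩

lemma not_isLeaf_nil (A : Params) (y : Node → ℕ → ℝ) (t : ℕ) : ¬ (state A y t).IsLeaf [] :=
  fun h => h.1 (singleton_false_mem_tree A y t)

lemma pulled_ne_nil (A : Params) (y : Node → ℕ → ℝ) (t : ℕ) : pulled A y t ≠ [] := by
  have h := (descend_spec A y (t + 1) (state A y t) (Q := fun _ => True) (fun _ _ _ _ => trivial)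
    (state A y t).depth [] trivial (by simp)).2
  intro h0
  have h0' : descend A y (t + 1) (state A y t) (state A y t).depth [] = [] := h0
  rw [h0'] at h
  rcases h with h | h
  · exact not_isLeaf_nil A y t h
  · exact h (Or.inl rfl)

/-! ### The run depends only on the rewards that have been received -/

lemma empMean_congr {y y' : ℕ → ℝ} {T : ℕ} (h : ∀ j < T, y j = y' j) :
    empMean y T = empMean y' T := by
  unfold empMean
  rw [Finset.sum_congr rfl fun j hj => h j (Finset.mem_range.1 hj)]

lemma empVar_congr {y y' : ℕ → ℝ} {T : ℕ} (h : ∀ j < T, y j = y' j) :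
    empVar y T = empVar y' T := by
  unfold empVar
  rw [empMean_congr h, Finset.sum_congr rfl fun j hj => by rw [h j (Finset.mem_range.1 hj)]]

lemma tau_congr (A : Params) {y y' : Node → ℕ → ℝ} (t : ℕ) {σ : State} {v : Node}
    (h : ∀ j < σ.pulls v, y v j = y' v j) : tau A y t σ v = tau A y' t σ v := by
  unfold tau
  rw [empVar_congr h]

lemma uVal_congr (A : Params) {y y' : Node → ℕ → ℝ} (t : ℕ) {σ : State} {v : Node}
    (h : ∀ j < σ.pulls v, y v j = y' v j) : uVal A y t σ v = uVal A y' t σ v := by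
  unfold uVal
  rw [empVar_congr h, empMean_congr h]

lemma select_congr (A : Params) {y y' : Node → ℕ → ℝ} (t : ℕ) {σ : State}
    (h : ∀ v, ∀ j < σ.pulls v, y v j = y' v j) : select A y t σ = select A y' t σ := by
  have hb : ∀ k v, bAux A y t σ k v = bAux A y' t σ k v := by
    intro k
    induction k with
    | zero => exact fun v => uVal_congr A t (h v)
    | succ k ih =>
      intro v
      simp only [bAux, ih, uVal_congr A t (h v)]
  have hc : bestChild A y t σ = bestChild A y' t σ := by
    funext v
    have hb' : ∀ v, bVal A y t σ v = bVal A y' t σ v := fun v => hb _ v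
    unfold bestChild
    rw [hb', hb']
  have hd : ∀ k v, descend A y t σ k v = descend A y' t σ k v := by
    intro k
    induction k with
    | zero => exact fun v => rfl
    | succ k ih =>
      intro v
      rw [descend, descend, ih, hc, tau_congr A t (h v)]
  exact hd _ _

/-- Agreement is required only on the rewards that the run with `y` has consumed. This asymmetric
form expresses adaptedness without a filtration. -/
lemma state_congr (A : Params) {y y' : Node → ℕ → ℝ} (t : ℕ)
    (h : ∀ v, ∀ j < (state A y t).pulls v, y v j = y' v j) : state A y t = state A y' t := by
  induction t with
  | zero => rfl
  | succ t ih =>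
    have h0 : ∀ v, ∀ j < (state A y t).pulls v, y v j = y' v j := fun v j hj =>
      h v j (hj.trans_le (state_pulls_mono A y v t.le_succ))
    have h1 := h (select A y (t + 1) (state A y t))
    rw [state_succ_pulls] at h1
    have ht := tau_congr A (t + 1)
      (σ := (state A y t).pull (select A y (t + 1) (state A y t))) h1
    rw [state, state, ← ih h0]
    unfold step
    rw [← select_congr A (t + 1) h0]
    dsimp only
    rw [ht]

lemma pulled_congr (A : Params) {y y' : Node → ℕ → ℝ} (t : ℕ)
    (h : ∀ v, ∀ j < (state A y t).pulls v, y v j = y' v j) : pulled A y t = pulled A y' t := by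
  rw [pulled, pulled, ← state_congr A t h, select_congr A (t + 1) h]

lemma regret_eq {X : Type*} (f : X → ℝ) (A : Params) (y : Node → ℕ → ℝ) (n : ℕ) :
    regret f A y n =
      ∑ t ∈ Finset.range n, ((⨆ z, f z) - y (pulled A y t) (pullIdx A y t)) := by
  unfold regret
  rw [← Finset.Ico_add_one_right_eq_Icc, Finset.sum_Ico_eq_sum_range]
  refine Finset.sum_congr (by simp) fun t _ => ?_
  rw [add_comm 1 t]
  rfl

/-! ### The statistical error and the threshold -/

lemma empVar_nonneg (y : ℕ → ℝ) (T : ℕ) : 0 ≤ empVar y T := by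
  unfold empVar; positivity

lemma statErr_antitone {b L V T T' : ℝ} (hb : 0 ≤ b) (hL : 0 ≤ L) (hV : 0 ≤ V) (hT : 0 < T)
    (h : T ≤ T') : statErr b L V T' ≤ statErr b L V T := by
  unfold statErr
  gcongr

lemma statErr_strictAnti {b L V T T' : ℝ} (hb : 0 < b) (hL : 0 < L) (hV : 0 ≤ V) (hT : 0 < T)
    (h : T < T') : statErr b L V T' < statErr b L V T := by
  unfold statErr
  have h1 : √(2 * V * L / T') ≤ √(2 * V * L / T) := by gcongr
  have h2 : 3 * b * 3 ^ 2 * L / T' < 3 * b * 3 ^ 2 * L / T := by gcongr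
  linarith

lemma statErr_mono {b L L' V T : ℝ} (hb : 0 ≤ b) (hV : 0 ≤ V) (hT : 0 ≤ T)
    (h : L ≤ L') : statErr b L V T ≤ statErr b L' V T := by
  unfold statErr
  gcongr

lemma threshold_pos {b L V p : ℝ} (hb : 0 < b) (hL : 0 < L) (hV : 0 ≤ V) (hp : 0 < p) :
    0 < threshold b L V p := by
  unfold threshold
  positivity

lemma threshold_mono {b L L' V p : ℝ} (hb : 0 ≤ b) (hV : 0 ≤ V) (hp : 0 ≤ p) (h : L ≤ L') :
    threshold b L V p ≤ threshold b L' V p := by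
  unfold threshold
  gcongr

lemma statErr_threshold {b L V p : ℝ} (hb : 0 < b) (hL : 0 < L) (hV : 0 ≤ V) (hp : 0 < p) :
    statErr b L V (threshold b L V p) = p := by
  have hr : √(V ^ 2 + 6 * b * p * V) ^ 2 = V ^ 2 + 6 * b * p * V :=
    Real.sq_sqrt (by positivity)
  unfold statErr threshold
  set r := √(V ^ 2 + 6 * b * p * V) with hr_def
  have hr0 : 0 ≤ r := Real.sqrt_nonneg _
  have hW : 0 < V + r + 3 * b * p := by positivity
  -- The closed form of the threshold works because `(V + r) ^ 2 = 2 V (V + r + 3 b p)`, which turns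
  -- the radicand into a perfect square.
  have h1 : 2 * V * L / ((V + r + 3 * b * p) * (3 ^ 2 * L / p ^ 2)) =
      (p * (V + r) / (3 * (V + r + 3 * b * p))) ^ 2 := by
    field_simp
    linear_combination (-1) * hr
  rw [h1, Real.sqrt_sq (by positivity)]
  field_simp

lemma statErr_le_of_threshold_le {b L V p T : ℝ} (hb : 0 < b) (hL : 0 < L) (hV : 0 ≤ V)
    (hp : 0 < p) (h : threshold b L V p ≤ T) : statErr b L V T ≤ p :=
  (statErr_antitone hb.le hL.le hV (threshold_pos hb hL hV hp) h).trans
    (statErr_threshold hb hL hV hp).le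

lemma lt_statErr_of_lt_threshold {b L V p T : ℝ} (hb : 0 < b) (hL : 0 < L) (hV : 0 ≤ V)
    (hp : 0 < p) (hT : 0 < T) (h : T < threshold b L V p) : p < statErr b L V T :=
  (statErr_threshold hb hL hV hp).symm.le.trans_lt (statErr_strictAnti hb hL hV hT h)

/-- The linear bound needs no information on `V`. It guarantees enough pulls for the empirical
variance to be reliable, after which the quadratic bound becomes effective. -/
lemma le_threshold_inv_depth {b L V : ℝ} {h : ℕ} (hb : 0 < b) (hL : 0 < L) (hV : 0 ≤ V)
    (hh : 1 ≤ h) : 27 * b * L * h ≤ threshold b L V (1 / (h : ℝ)) ∧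
      18 * V * L * (h : ℝ) ^ 2 ≤ threshold b L V (1 / (h : ℝ)) := by
  have hh' : (0 : ℝ) < h := by exact_mod_cast hh
  unfold threshold
  have hr : V ≤ √(V ^ 2 + 6 * b * (1 / (h : ℝ)) * V) :=
    Real.le_sqrt_of_sq_le (by have : 0 ≤ 6 * b * (1 / (h : ℝ)) * V := by positivity
                              linarith)
  set r := √(V ^ 2 + 6 * b * (1 / (h : ℝ)) * V)
  have e : (V + r + 3 * b * (1 / (h : ℝ))) * (3 ^ 2 * L / (1 / (h : ℝ)) ^ 2) =
      (V + r) * (9 * L * h ^ 2) + 27 * b * L * h := by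
    field_simp
    ring
  rw [e]
  have h1 : 0 ≤ 27 * b * L * h := by positivity
  have h2 : 2 * V * (9 * L * (h : ℝ) ^ 2) ≤ (V + r) * (9 * L * (h : ℝ) ^ 2) := by
    gcongr; linarith
  have h3 : 0 ≤ 2 * V * (9 * L * (h : ℝ) ^ 2) := by positivity
  constructor <;> linarith

lemma tPlus_mono : Monotone tPlus := fun s t h => by
  unfold tPlus
  exact Nat.pow_le_pow_right (by norm_num) (by gcongr)

lemma lt_tPlus (t : ℕ) : t < tPlus t := Nat.lt_pow_succ_log_self (by norm_num) t

lemma tPlus_le {t : ℕ} (ht : t ≠ 0) : tPlus t ≤ 2 * t := by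
  unfold tPlus
  rw [pow_succ, mul_comm]
  exact Nat.mul_le_mul_left 2 (Nat.pow_log_le_self 2 ht)

lemma tPlus_pos (t : ℕ) : 0 < tPlus t := (Nat.zero_le t).trans_lt (lt_tPlus t)

lemma logTerm_mono {δ : ℝ} (hδ : 0 < δ) : Monotone (logTerm δ) := fun s t h => by
  unfold logTerm
  have h1 : (0 : ℝ) < tPlus s := by exact_mod_cast tPlus_pos s
  have h1' : (0 : ℝ) < tPlus t := by exact_mod_cast tPlus_pos t
  have h2 : (tPlus s : ℝ) ≤ tPlus t := by exact_mod_cast tPlus_mono h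
  apply Real.log_le_log (by positivity)
  gcongr

/-! ### Leaves are pulled less often than their threshold -/

/-- A leaf was not expanded at its last pull, so it was below its threshold then. Without new pulls
the empirical variance is frozen and the threshold can only grow with time. The later time `s` is
kept free so that the induction passes through rounds in which the leaf is not pulled. -/
lemma isLeaf_pulls_lt_tau (A : Params) (y : Node → ℕ → ℝ) (hb : 0 < A.b) (hδ : 0 < A.δ)
    (hφ : ∀ h, 0 ≤ A.φ h) (t : ℕ) (v : Node) (hv : (state A y t).IsLeaf v) (s : ℕ) (hs : t ≤ s) :
    (state A y t).pulls v = 0 ∨ ((state A y t).pulls v : ℝ) < tau A y s (state A y t) v := by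
  induction t with
  | zero => left; rfl
  | succ t ih =>
    have hl : (state A y t).IsLeaf v :=
      ⟨fun h => hv.1 (subset_step_tree A y (t + 1) _ h),
        fun h => hv.2 (subset_step_tree A y (t + 1) _ h)⟩
    by_cases hsel : v = select A y (t + 1) (state A y t)
    · right
      rw [state] at hv ⊢
      unfold step at hv ⊢
      rw [← hsel] at hv ⊢
      dsimp only at hv ⊢
      split_ifs at hv ⊢ with h
      · exact absurd (Finset.mem_union_right _ (by simp)) hv.1
      · have h1 : ((((state A y t).pull v).pulls v : ℕ) : ℝ) <
            tau A y (t + 1) ((state A y t).pull v) v := by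
          by_contra h2
          exact h ⟨hl, not_lt.1 h2⟩
        exact h1.trans_le
          (threshold_mono hb.le (empVar_nonneg _ _) (hφ _) (logTerm_mono hδ hs))
    · have hp : (state A y (t + 1)).pulls v = (state A y t).pulls v := by
        rw [state_succ_pulls]
        exact Function.update_of_ne hsel _ _
      have := ih hl (by omega)
      simpa only [tau, hp] using this

/-! ### Optimism -/

/-- In the application `O v` says that the cell of `v` contains the maximizer. Every such node has a
child of the same kind, so the minimum in the backward recursion never falls below `m`, whatever the
recursion depth. -/
lemma le_bVal_of_le_uVal (A : Params) (y : Node → ℕ → ℝ) (t : ℕ) (σ : State) {O : Node → Prop}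
    {m : EReal} (hO : ∀ v, O v → O (false :: v) ∨ O (true :: v))
    (hU : ∀ v, v ≠ [] → O v → m ≤ uVal A y t σ v) (v : Node) (hv : v ≠ []) (hOv : O v) :
    m ≤ bVal A y t σ v := by
  have key : ∀ k v, v ≠ [] → O v → m ≤ bAux A y t σ k v := by
    intro k
    induction k with
    | zero => exact hU
    | succ k ih =>
      intro v hv hOv
      unfold bAux
      split_ifs
      · exact hU v hv hOv
      · refine le_min (hU v hv hOv) ?_
        rcases hO v hOv with h | h
        · exact le_max_of_le_left (ih _ (by simp) h)
        · exact le_max_of_le_right (ih _ (by simp) h)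
  exact key _ v hv hOv

/-- The pulled node and its parent are optimistic, and the parent has reached its threshold. -/
lemma pulled_spec (A : Params) (y : Node → ℕ → ℝ) (t : ℕ) {O : Node → Prop} {m : EReal}
    (hO0 : O []) (hO : ∀ v, O v → O (false :: v) ∨ O (true :: v))
    (hU : ∀ v, v ≠ [] → O v → m ≤ uVal A y (t + 1) (state A y t) v) :
    m ≤ uVal A y (t + 1) (state A y t) (pulled A y t) ∧
    ((state A y t).IsLeaf (pulled A y t) ∨
      (pullIdx A y t : ℝ) < tau A y (t + 1) (state A y t) (pulled A y t)) ∧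
    ∀ c p, pulled A y t = c :: p → p ≠ [] → m ≤ uVal A y (t + 1) (state A y t) p ∧
      tau A y (t + 1) (state A y t) p ≤ (state A y t).pulls p := by
  set σ := state A y t with hσ
  -- Invariant of the traversal. Below the root, `B ≥ m` forces the larger child value to be at
  -- least `m`; at the root the same comes from the optimistic child.
  let Q : Node → Prop := fun v => (v ≠ [] → m ≤ bVal A y (t + 1) σ v) ∧
    ∀ c p, v = c :: p → p ≠ [] → m ≤ uVal A y (t + 1) σ p ∧ tau A y (t + 1) σ p ≤ σ.pulls p
  have hstep : ∀ v, Q v → ¬ σ.IsLeaf v → (v = [] ∨ tau A y (t + 1) σ v ≤ σ.pulls v) →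
      Q (bestChild A y (t + 1) σ v) := by
    intro v hv hl hp
    refine ⟨fun _ => ?_, ?_⟩
    · rw [bVal_bestChild]
      by_cases hv0 : v = []
      · subst hv0
        rcases hO _ hO0 with h | h
        · exact le_max_of_le_left (le_bVal_of_le_uVal A y _ σ hO hU _ (by simp) h)
        · exact le_max_of_le_right (le_bVal_of_le_uVal A y _ σ hO hU _ (by simp) h)
      · have := hv.1 hv0
        rw [bVal_of_not_isLeaf A y _ hl] at this
        exact this.trans (min_le_right _ _)
    · intro c p hcp hp0
      obtain ⟨c', hc'⟩ := bestChild_eq_cons A y (t + 1) σ v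
      rw [hc', List.cons.injEq] at hcp
      rw [← hcp.2] at hp0 ⊢
      exact ⟨(hv.1 hp0).trans (bVal_le_uVal _ _ _ _ _), hp.resolve_left hp0⟩
  have h := descend_spec A y (t + 1) σ hstep σ.depth [] ⟨fun h => absurd rfl h, by simp⟩ (by simp)
  change Q (pulled A y t) ∧ (σ.IsLeaf (pulled A y t) ∨ ¬ (pulled A y t = [] ∨
    tau A y (t + 1) σ (pulled A y t) ≤ σ.pulls (pulled A y t))) at h
  refine ⟨(h.1.1 (pulled_ne_nil A y t)).trans (bVal_le_uVal _ _ _ _ _), ?_, h.1.2⟩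
  rcases h.2 with h | h
  · exact Or.inl h
  · push Not at h
    exact Or.inr h.2

/-! ### Counting -/

lemma sum_range_one_div_sqrt_le (m : ℕ) :
    ∑ k ∈ Finset.range m, 1 / √((k : ℝ) + 1) ≤ 2 * √(m : ℝ) := by
  induction m with
  | zero => simp
  | succ m ih =>
    rw [Finset.sum_range_succ]
    have h0 : (0 : ℝ) ≤ m := by positivity
    have h1 : 0 < √((m : ℝ) + 1) := Real.sqrt_pos.2 (by positivity)
    have h2 := Real.sq_sqrt (show (0 : ℝ) ≤ (m : ℝ) + 1 by positivity)
    have h3 := Real.sq_sqrt h0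
    have h4 : 0 ≤ √(m : ℝ) := Real.sqrt_nonneg _
    have h5 : 1 / √((m : ℝ) + 1) ≤ 2 * √((m : ℝ) + 1) - 2 * √(m : ℝ) := by
      rw [div_le_iff₀ h1]
      nlinarith [sq_nonneg (√((m : ℝ) + 1) - √(m : ℝ))]
    push_cast
    linarith

/-- Rounds are separated by the number of earlier pulls. With fewer than `m`, the pairs of node and
index are distinct, so each node contributes at most `2 √m`; each other round contributes at most `1
/ √m`. -/
lemma sum_one_div_sqrt_pullIdx_le (A : Params) (y : Node → ℕ → ℝ) {n m : ℕ} (hm : 0 < m)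
    {S : Finset ℕ} (hS : S ⊆ Finset.range n) :
    ∑ t ∈ S, 1 / √((pullIdx A y t : ℝ) + 1) ≤
      (S.image (pulled A y)).card * (2 * √(m : ℝ)) + n / √(m : ℝ) := by
  have hm' : (0 : ℝ) < m := by exact_mod_cast hm
  rw [← Finset.sum_filter_add_sum_filter_not S (fun t => pullIdx A y t < m)]
  refine add_le_add ?_ ?_
  · let F : Node × ℕ → ℝ := fun q => 1 / √((q.2 : ℝ) + 1)
    calc ∑ t ∈ S with pullIdx A y t < m, 1 / √((pullIdx A y t : ℝ) + 1)
        = ∑ q ∈ (S.filter fun t => pullIdx A y t < m).image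
            fun t => (pulled A y t, pullIdx A y t), F q := by
          rw [Finset.sum_image fun s _ t _ h => pulled_pullIdx_injective A y h]
      _ ≤ ∑ q ∈ S.image (pulled A y) ×ˢ Finset.range m, F q := by
          apply Finset.sum_le_sum_of_subset_of_nonneg
          · intro q hq
            simp only [Finset.mem_image, Finset.mem_filter] at hq
            obtain ⟨t, ⟨ht, htm⟩, rfl⟩ := hq
            exact Finset.mk_mem_product (Finset.mem_image_of_mem _ ht) (Finset.mem_range.2 htm)
          · intro q _ _
            positivity
      _ = (S.image (pulled A y)).card * ∑ k ∈ Finset.range m, 1 / √((k : ℝ) + 1) := by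
          rw [Finset.sum_product]
          simp [F]
      _ ≤ _ := by gcongr; exact sum_range_one_div_sqrt_le m
  · calc ∑ t ∈ S with ¬ pullIdx A y t < m, 1 / √((pullIdx A y t : ℝ) + 1)
        ≤ ∑ t ∈ S with ¬ pullIdx A y t < m, 1 / √(m : ℝ) := by
          apply Finset.sum_le_sum
          intro t ht
          have : (m : ℝ) ≤ pullIdx A y t := by
            exact_mod_cast not_lt.1 (Finset.mem_filter.1 ht).2
          gcongr
          linarith
      _ ≤ n / √(m : ℝ) := by
          rw [Finset.sum_const, nsmul_eq_mul, mul_one_div]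
          gcongr
          simpa using Finset.card_le_card ((Finset.filter_subset _ _).trans hS)

/-- The factor `2` passes from nodes to parents. The three terms count the root, the parents at
depths from `1` to `H - 1`, which are near-optimal, and the deeper parents, each of which uses `θ`
of the `n` available pulls. -/
lemma card_le_of_parents {W : Finset Node} {N : Node → ℕ} {g : Node → ℝ} {fs C d θ : ℝ} {n H : ℕ}
    (hC : 0 < C) (hd : 0 < d) (hθ : 0 < θ) (hN : ∀ F : Finset Node, ∑ v ∈ F, N v ≤ n)
    (hcount : ∀ h : ℕ, 1 ≤ h →
      (Set.ncard {v : Node | v.length = h ∧ fs - 3 * (1 / (h : ℝ)) ≤ g v} : ℝ) ≤ C * (h : ℝ) ^ d)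
    (hne : ∀ v ∈ W, v ≠ [])
    (hW : ∀ c p, c :: p ∈ W → p ≠ [] → fs - 3 * (1 / (p.length : ℝ)) ≤ g p ∧
      (H ≤ p.length → θ ≤ N p)) :
    (W.card : ℝ) ≤ 2 * (1 + C * (H : ℝ) ^ (d + 1) + n / θ) := by
  classical
  let P := W.image List.tail
  have hWP : W.card ≤ 2 * P.card := by
    have : W ⊆ P.image (List.cons false) ∪ P.image (List.cons true) := by
      intro v hv
      obtain ⟨c, p, rfl⟩ := List.exists_cons_of_ne_nil (hne v hv)
      have hp : p ∈ P := Finset.mem_image.2 ⟨c :: p, hv, rfl⟩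
      cases c
      · exact Finset.mem_union_left _ (Finset.mem_image_of_mem _ hp)
      · exact Finset.mem_union_right _ (Finset.mem_image_of_mem _ hp)
    calc W.card ≤ _ := Finset.card_le_card this
      _ ≤ _ := Finset.card_union_le _ _
      _ ≤ P.card + P.card := add_le_add Finset.card_image_le Finset.card_image_le
      _ = 2 * P.card := by ring
  have hP : ∀ p ∈ P, p ≠ [] → fs - 3 * (1 / (p.length : ℝ)) ≤ g p ∧
      (H ≤ p.length → θ ≤ N p) := by
    intro p hp hp0
    obtain ⟨v, hv, rfl⟩ := Finset.mem_image.1 hp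
    obtain ⟨c, p, rfl⟩ := List.exists_cons_of_ne_nil (hne v hv)
    exact hW c p hv hp0
  let S : ℕ → Finset Node := fun h => P.filter fun p => p.length = h
  let PH := P.filter fun p => p ≠ [] ∧ H ≤ p.length
  have hsub : P ⊆ {[]} ∪ (Finset.Ico 1 H).biUnion S ∪ PH := by
    intro p hp
    by_cases hp0 : p = []
    · simp [hp0]
    · by_cases hH : H ≤ p.length
      · exact Finset.mem_union_right _ (Finset.mem_filter.2 ⟨hp, hp0, hH⟩)
      · refine Finset.mem_union_left _ (Finset.mem_union_right _ ?_)
        exact Finset.mem_biUnion.2 ⟨p.length, Finset.mem_Ico.2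
          ⟨List.length_pos_iff.2 hp0, not_le.1 hH⟩, Finset.mem_filter.2 ⟨hp, rfl⟩⟩
  have hS : ∀ h ∈ Finset.Ico 1 H, ((S h).card : ℝ) ≤ C * (H : ℝ) ^ d := by
    intro h hh
    rw [Finset.mem_Ico] at hh
    calc ((S h).card : ℝ) ≤ (Set.ncard {v : Node | v.length = h ∧
          fs - 3 * (1 / (h : ℝ)) ≤ g v} : ℝ) := by
          have hfin : {v : Node | v.length = h ∧ fs - 3 * (1 / (h : ℝ)) ≤ g v}.Finite :=
            (List.finite_length_eq Bool h).subset fun v hv => hv.1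
          rw [← Set.ncard_coe_finset]
          refine Nat.cast_le.2 (Set.ncard_le_ncard (fun p hp => ?_) hfin)
          obtain ⟨hp1, hp2⟩ := Finset.mem_filter.1 (Finset.mem_coe.1 hp)
          refine ⟨hp2, ?_⟩
          rw [← hp2]
          refine (hP p hp1 ?_).1
          rintro rfl
          simp at hp2
          omega
      _ ≤ C * (h : ℝ) ^ d := hcount h hh.1
      _ ≤ C * (H : ℝ) ^ d := by
          gcongr
          exact_mod_cast hh.2.le
  have hPH : (PH.card : ℝ) ≤ n / θ := by
    rw [le_div_iff₀ hθ, ← nsmul_eq_mul]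
    calc PH.card • θ ≤ ∑ p ∈ PH, (N p : ℝ) := by
          apply Finset.card_nsmul_le_sum
          intro p hp
          obtain ⟨h1, h2, h3⟩ := Finset.mem_filter.1 hp
          exact (hP p h1 h2).2 h3
      _ ≤ n := by exact_mod_cast hN PH
  have hcard : (P.card : ℝ) ≤ 1 + C * (H : ℝ) ^ (d + 1) + n / θ := by
    have h1 : P.card ≤ 1 + ∑ h ∈ Finset.Ico 1 H, (S h).card + PH.card := by
      calc P.card ≤ _ := Finset.card_le_card hsub
        _ ≤ _ := Finset.card_union_le _ _
        _ ≤ _ := by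
            gcongr
            refine (Finset.card_union_le _ _).trans ?_
            gcongr
            · simp
            · exact Finset.card_biUnion_le
    have h2 : ∑ h ∈ Finset.Ico 1 H, ((S h).card : ℝ) ≤ C * (H : ℝ) ^ (d + 1) := by
      refine (Finset.sum_le_card_nsmul _ _ _ hS).trans ?_
      rw [nsmul_eq_mul, Nat.card_Ico]
      rcases Nat.eq_zero_or_pos H with rfl | hH
      · simp [Real.zero_rpow (show d + 1 ≠ 0 by linarith)]
      · have hH' : (0 : ℝ) < H := by exact_mod_cast hH
        rw [Real.rpow_add hH', Real.rpow_one]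
        have : ((H - 1 : ℕ) : ℝ) ≤ H := by exact_mod_cast Nat.sub_le _ _
        have h0 : 0 ≤ C * (H : ℝ) ^ d := by positivity
        nlinarith
    have h3 : (P.card : ℝ) ≤ 1 + ∑ h ∈ Finset.Ico 1 H, ((S h).card : ℝ) + PH.card := by
      exact_mod_cast h1
    linarith
  have h4 : (W.card : ℝ) ≤ 2 * P.card := by exact_mod_cast hWP
  linarith

/-! ### The regret on a favourable sample path -/

/-- The confidence bound for the first `T` rewards of a node with mean `m`; the empirical variance
is at least `ε / 2` if `T` is at least `κ * L`. -/
def ConfAt (y : ℕ → ℝ) (m b L κ ε : ℝ) (T : ℕ) : Prop :=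
  |empMean y T - m| ≤ statErr b L (empVar y T) T ∧ (κ * L ≤ T → ε / 2 ≤ empVar y T)

/-- A sample path is favourable if the confidence bounds with the logarithmic term `L` hold for all
nodes that are pulled in the first `n` rounds. -/
def Favourable (A : Params) (y : Node → ℕ → ℝ) (g : Node → ℝ) (n : ℕ) (L κ ε : ℝ) : Prop :=
  ∀ v, 0 < (state A y n).pulls v → ∀ T : ℕ, 1 ≤ T → T ≤ n → ConfAt (y v) (g v) A.b L κ ε T

/-- An upper bound for the gap of the pulled node, and properties of its parent. -/
lemma round_bound {A : Params} {y : Node → ℕ → ℝ} {g : Node → ℝ} {O : Node → Prop}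
    {fs ε κ L ℓ : ℝ} {n H t : ℕ} (hb : 0 < A.b) (hδ : 0 < A.δ)
    (hφ : A.φ = fun h : ℕ => 1 / (h : ℝ))
    (hO0 : O []) (hO : ∀ v, O v → O (false :: v) ∨ O (true :: v))
    (hOg : ∀ v, v ≠ [] → O v → fs - 1 / (v.length : ℝ) ≤ g v)
    (hg : ∀ v, fs - g v ≤ 1) (hV : ∀ v T, empVar (y v) T ≤ A.b ^ 2)
    (hfav : Favourable A y g n L κ ε) (hε : 0 < ε) (hκ : κ ≤ 27 * A.b * H) (hH : 1 ≤ H)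
    (hL : 0 < L) (hℓ : 1 / 2 ≤ ℓ) (hLℓ : ℓ ≤ 2 * L)
    (htn : t < n) (hLt : L ≤ logTerm A.δ (t + 1)) (hLt' : logTerm A.δ (t + 1) ≤ 4 * ℓ) :
    fs - g (pulled A y t) ≤
      3 * (1 + 94 * A.b) * √ℓ * (1 / √((pullIdx A y t : ℝ) + 1)) ∧
    ∀ c p, pulled A y t = c :: p → p ≠ [] →
      fs - 3 * (1 / (p.length : ℝ)) ≤ g p ∧
      (H ≤ p.length → 4 * ε * ℓ * (H : ℝ) ^ 2 ≤ (state A y n).pulls p) := by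
  have hpn : ∀ v, (state A y t).pulls v ≤ (state A y n).pulls v := fun v =>
    state_pulls_mono A y v htn.le
  have hφ0 : ∀ h, 0 ≤ A.φ h := fun h => by rw [hφ]; positivity
  have hφv : ∀ v : Node, v ≠ [] → 0 < A.φ v.length := fun v hv => by
    have : 0 < v.length := List.length_pos_iff.2 hv
    rw [hφ]; positivity
  have hLt0 : 0 < logTerm A.δ (t + 1) := hL.trans_le hLt
  have hconf : ∀ v, 0 < (state A y t).pulls v →
      |empMean (y v) ((state A y t).pulls v) - g v| ≤ statErr A.b (logTerm A.δ (t + 1))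
        (empVar (y v) ((state A y t).pulls v)) ((state A y t).pulls v) := fun v hv =>
    ((hfav v (hv.trans_le (hpn v)) _ hv ((pulls_le A y t v).trans htn.le)).1).trans
      (statErr_mono hb.le (empVar_nonneg _ _) (by positivity) hLt)
  have hU : ∀ v, v ≠ [] → O v → (fs : EReal) ≤ uVal A y (t + 1) (state A y t) v := by
    intro v hv hOv
    unfold uVal
    split_ifs with h0
    · exact le_top
    · rw [EReal.coe_le_coe_iff]
      have h1 := (abs_le.1 (hconf v (Nat.pos_of_ne_zero h0))).1
      have h2 := hOg v hv hOv
      simp only [hφ] at *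
      linarith
  have hUle : ∀ v, 0 < (state A y t).pulls v →
      (fs : EReal) ≤ uVal A y (t + 1) (state A y t) v →
      fs ≤ g v + A.φ v.length + 2 * statErr A.b (logTerm A.δ (t + 1))
        (empVar (y v) ((state A y t).pulls v)) ((state A y t).pulls v) := by
    intro v hv h
    unfold uVal at h
    rw [if_neg hv.ne', EReal.coe_le_coe_iff] at h
    have h1 := (abs_le.1 (hconf v hv)).2
    linarith
  obtain ⟨h1, h2, h3⟩ := pulled_spec A y t hO0 hO hU
  constructor
  · have hne := pulled_ne_nil A y t
    have hk1 : 0 < √((pullIdx A y t : ℝ) + 1) := Real.sqrt_pos.2 (by positivity)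
    -- At a first pull `U` is infinite and carries no information, so the trivial gap `1` is
    -- compared with `3 √ℓ`.
    rcases Nat.eq_zero_or_pos (pullIdx A y t) with hk | hk
    · rw [hk]
      have h4 : (1 : ℝ) / 3 ≤ √ℓ := Real.le_sqrt_of_sq_le (by linarith)
      simp only [Nat.cast_zero, zero_add, Real.sqrt_one, div_one, mul_one]
      have := hg (pulled A y t)
      nlinarith
    · have hlt : (pullIdx A y t : ℝ) < tau A y (t + 1) (state A y t) (pulled A y t) := by
        rcases h2 with h2 | h2
        · exact (isLeaf_pulls_lt_tau A y hb hδ hφ0 t _ h2 (t + 1) t.le_succ).resolve_left hk.ne'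
        · exact h2
      have hk' : (0 : ℝ) < pullIdx A y t := by exact_mod_cast hk
      have hk'' : (1 : ℝ) ≤ pullIdx A y t := by exact_mod_cast hk
      have h4 := lt_statErr_of_lt_threshold hb hLt0 (empVar_nonneg _ _) (hφv _ hne) hk' hlt
      have h5 := hUle _ hk h1
      change fs ≤ _ + _ + 2 * statErr A.b (logTerm A.δ (t + 1))
        (empVar (y (pulled A y t)) (pullIdx A y t)) (pullIdx A y t) at h5
      change _ < statErr A.b (logTerm A.δ (t + 1))
        (empVar (y (pulled A y t)) (pullIdx A y t)) (pullIdx A y t) at h4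
      have hVk := hV (pulled A y t) (pullIdx A y t)
      have hV0 := empVar_nonneg (y (pulled A y t)) (pullIdx A y t)
      set V := empVar (y (pulled A y t)) (pullIdx A y t)
      set k : ℝ := (pullIdx A y t : ℝ)
      set L' := logTerm A.δ (t + 1)
      have hq0 : 0 ≤ L' / k := by positivity
      -- If `L' / k ≤ 1`, its square root dominates it and `3 SE ≤ 3 (3 * 13 / 9 + 27) b √(L' / k)`,
      -- which gives `94`; here `13 / 9` exceeds `√2`. Otherwise the gap is at most `1 ≤ √(L' / k)`.
      have h6 : fs - g (pulled A y t) ≤ (1 + 94 * A.b) * √(L' / k) := by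
        have hs0 : 0 ≤ √(L' / k) := Real.sqrt_nonneg _
        rcases le_total (L' / k) 1 with hq | hq
        · have h7 : L' / k ≤ √(L' / k) := Real.le_sqrt_of_sq_le (by nlinarith)
          have h8 : √(2 * V * L' / k) ≤ 13 / 9 * A.b * √(L' / k) := by
            rw [mul_div_assoc, Real.sqrt_mul (by positivity)]
            gcongr
            apply Real.sqrt_le_iff.2
            exact ⟨by positivity, by nlinarith⟩
          have h9 : statErr A.b L' V k ≤ 3 * (13 / 9 * A.b * √(L' / k)) +
              27 * A.b * √(L' / k) := by
            unfold statErr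
            have : 3 * A.b * 3 ^ 2 * L' / k = 27 * A.b * (L' / k) := by ring
            rw [this]
            gcongr
          nlinarith
        · have h7 : 1 ≤ √(L' / k) := Real.one_le_sqrt.2 hq
          have := hg (pulled A y t)
          have h8 : 0 ≤ 94 * A.b * √(L' / k) := by positivity
          linarith
      have h7 : √(L' / k) ≤ 3 * √ℓ * (1 / √(k + 1)) := by
        rw [mul_one_div, ← Real.sqrt_sq (show (0 : ℝ) ≤ 3 by norm_num),
          ← Real.sqrt_mul (by positivity), ← Real.sqrt_div (by positivity)]
        apply Real.sqrt_le_sqrt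
        rw [div_le_div_iff₀ hk' (by positivity)]
        nlinarith
      calc _ ≤ _ := h6
        _ ≤ (1 + 94 * A.b) * (3 * √ℓ * (1 / √(k + 1))) := by gcongr
        _ = _ := by ring
  · intro c p hcp hp
    obtain ⟨h4, h5⟩ := h3 c p hcp hp
    have hp1 : 1 ≤ p.length := List.length_pos_iff.2 hp
    have hV0 := empVar_nonneg (y p) ((state A y t).pulls p)
    have hτ : 0 < tau A y (t + 1) (state A y t) p := threshold_pos hb hLt0 hV0 (hφv p hp)
    have hT : 0 < (state A y t).pulls p := by exact_mod_cast hτ.trans_le h5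
    have h6 := hUle p hT h4
    have h7 := statErr_le_of_threshold_le hb hLt0 hV0 (hφv p hp) h5
    obtain ⟨h8, h9⟩ := le_threshold_inv_depth hb hLt0 hV0 hp1
    simp only [tau, hφ] at h5 h6 h7
    refine ⟨by linarith, fun hHp => ?_⟩
    have hHp' : (H : ℝ) ≤ p.length := by exact_mod_cast hHp
    have hH' : (1 : ℝ) ≤ H := by exact_mod_cast hH
    have h10 : κ * L ≤ (state A y t).pulls p := by
      calc κ * L ≤ 27 * A.b * H * L := by gcongr
        _ = 27 * A.b * L * H := by ring
        _ ≤ 27 * A.b * logTerm A.δ (t + 1) * p.length := by gcongr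
        _ ≤ _ := h8.trans h5
    have h11 := (hfav p (hT.trans_le (hpn p)) _ hT ((pulls_le A y t p).trans htn.le)).2 h10
    have h12 : ((state A y t).pulls p : ℝ) ≤ (state A y n).pulls p := by exact_mod_cast hpn p
    calc 4 * ε * ℓ * (H : ℝ) ^ 2 ≤ 4 * ε * (2 * L) * (H : ℝ) ^ 2 := by gcongr
      _ ≤ 18 * (ε / 2) * L * (H : ℝ) ^ 2 := by
          have : 0 < ε * L * (H : ℝ) ^ 2 := by positivity
          linarith
      _ ≤ 18 * empVar (y p) ((state A y t).pulls p) * logTerm A.δ (t + 1) *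
          (p.length : ℝ) ^ 2 := by gcongr
      _ ≤ _ := (h9.trans h5).trans h12

lemma sum_gap_le {A : Params} {y : Node → ℕ → ℝ} {g : Node → ℝ} {O : Node → Prop}
    {fs C d ε κ L ℓ : ℝ} {n H : ℕ} {S : Finset ℕ} (hb : 0 < A.b) (hδ : 0 < A.δ)
    (hφ : A.φ = fun h : ℕ => 1 / (h : ℝ))
    (hO0 : O []) (hO : ∀ v, O v → O (false :: v) ∨ O (true :: v))
    (hOg : ∀ v, v ≠ [] → O v → fs - 1 / (v.length : ℝ) ≤ g v)
    (hg : ∀ v, fs - g v ≤ 1) (hV : ∀ v T, empVar (y v) T ≤ A.b ^ 2) (hC : 0 < C) (hd : 0 < d)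
    (hcount : ∀ h : ℕ, 1 ≤ h →
      (Set.ncard {v : Node | v.length = h ∧ fs - 3 * (1 / (h : ℝ)) ≤ g v} : ℝ) ≤ C * (h : ℝ) ^ d)
    (hfav : Favourable A y g n L κ ε) (hε : 0 < ε) (hκ : κ ≤ 27 * A.b * H) (hH : 1 ≤ H)
    (hL : 0 < L) (hℓ : 1 / 2 ≤ ℓ) (hLℓ : ℓ ≤ 2 * L) (hSn : S ⊆ Finset.range n)
    (hLt : ∀ t ∈ S, L ≤ logTerm A.δ (t + 1)) (hLt' : ∀ t ∈ S, logTerm A.δ (t + 1) ≤ 4 * ℓ) :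
    ∑ t ∈ S, (fs - g (pulled A y t)) ≤
      3 * (1 + 94 * A.b) *
        (8 * (1 + C) * (ℓ * (H : ℝ) ^ (d + 2)) + (2 / ε + 1) * (n / H)) := by
  have hH1 : (1 : ℝ) ≤ H := by exact_mod_cast hH
  have hH0 : (0 : ℝ) < H := by linarith
  have hround := fun t ht => round_bound (t := t) hb hδ hφ hO0 hO hOg hg hV hfav hε hκ hH hL hℓ hLℓ
    (Finset.mem_range.1 (hSn ht)) (hLt t ht) (hLt' t ht)
  -- This cut matches the order of the pulls of deep parents, so that both parts of the sum
  -- contribute `n / H`. Rounding up costs at most a factor `2` in `√m`, because `ℓ H ^ 2 ≥ 1 / 2`.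
  set m := ⌈ℓ * (H : ℝ) ^ 2⌉₊ with hm_def
  have hℓH : 0 < ℓ * (H : ℝ) ^ 2 := by positivity
  have hm : 0 < m := Nat.ceil_pos.2 hℓH
  have hℓ0 : 0 < ℓ := by linarith
  have hsℓ : 0 < √ℓ := Real.sqrt_pos.2 hℓ0
  have hm1 : √ℓ * H ≤ √(m : ℝ) := by
    rw [← Real.sqrt_sq hH0.le, ← Real.sqrt_mul hℓ0.le]
    exact Real.sqrt_le_sqrt (Nat.le_ceil _)
  have hm2 : √(m : ℝ) ≤ 2 * (√ℓ * H) := by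
    rw [← Real.sqrt_sq hH0.le, ← Real.sqrt_mul hℓ0.le,
      ← Real.sqrt_sq (show (0 : ℝ) ≤ 2 by norm_num), ← Real.sqrt_mul (by positivity)]
    apply Real.sqrt_le_sqrt
    have := (Nat.ceil_lt_add_one hℓH.le).le
    have h1 : 1 / 2 ≤ ℓ * (H : ℝ) ^ 2 := by
      have : (1 : ℝ) ≤ (H : ℝ) ^ 2 := one_le_pow₀ hH1
      nlinarith
    linarith
  have hW := card_le_of_parents (W := S.image (pulled A y)) (N := (state A y n).pulls) (n := n)
    (H := H) (θ := 4 * ε * ℓ * (H : ℝ) ^ 2) hC hd (by positivity) (sum_pulls_le A y n) hcount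
    (by
      intro v hv
      obtain ⟨t, -, rfl⟩ := Finset.mem_image.1 hv
      exact pulled_ne_nil A y t)
    (by
      intro c p hcp hp
      obtain ⟨t, ht, h⟩ := Finset.mem_image.1 hcp
      exact (hround t ht).2 c p h hp)
  have hH2 : (1 : ℝ) ≤ (H : ℝ) ^ (d + 1) := Real.one_le_rpow hH1 (by linarith)
  have hH3 : (H : ℝ) ^ (d + 2) = (H : ℝ) ^ (d + 1) * H := by
    rw [← Real.rpow_add_one hH0.ne']; congr 1; ring
  calc ∑ t ∈ S, (fs - g (pulled A y t))
      ≤ ∑ t ∈ S, 3 * (1 + 94 * A.b) * √ℓ * (1 / √((pullIdx A y t : ℝ) + 1)) :=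
        Finset.sum_le_sum fun t ht => (hround t ht).1
    _ = 3 * (1 + 94 * A.b) * (√ℓ * ∑ t ∈ S, 1 / √((pullIdx A y t : ℝ) + 1)) := by
        rw [← Finset.mul_sum]; ring
    _ ≤ 3 * (1 + 94 * A.b) * (√ℓ * ((S.image (pulled A y)).card * (2 * √(m : ℝ)) +
          n / √(m : ℝ))) := by
        gcongr
        exact sum_one_div_sqrt_pullIdx_le A y hm hSn
    _ ≤ 3 * (1 + 94 * A.b) * (√ℓ * ((2 * (1 * (H : ℝ) ^ (d + 1) + C * (H : ℝ) ^ (d + 1) +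
          n / (4 * ε * ℓ * (H : ℝ) ^ 2))) * (2 * (2 * (√ℓ * H))) + n / (√ℓ * H))) := by
        gcongr
        linarith
    _ = _ := by
        rw [hH3]
        have hs := Real.sq_sqrt hℓ0.le
        generalize √ℓ = s at *
        subst hs
        field_simp
        ring

/-! ### Measurability of the run -/

instance instMeasurableSpaceNode : MeasurableSpace (List Bool) := ⊤

instance instDiscreteMeasurableSpaceNode : DiscreteMeasurableSpace (List Bool) :=
  ⟨fun _ => trivial⟩

instance instMeasurableSpaceTree : MeasurableSpace (Finset Node) := ⊤

instance instDiscreteMeasurableSpaceTree : DiscreteMeasurableSpace (Finset Node) :=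
  ⟨fun _ => trivial⟩

instance instMeasurableSpaceState : MeasurableSpace State :=
  MeasurableSpace.comap (fun σ => (σ.tree, σ.pulls)) inferInstance

section Measurability

variable {Ω : Type*} [MeasurableSpace Ω]

lemma measurable_state_iff {σ : Ω → State} :
    Measurable σ ↔ (Measurable fun ω => (σ ω).tree) ∧ ∀ v, Measurable fun ω => (σ ω).pulls v := by
  rw [measurable_comap_iff]
  refine ⟨fun h => ⟨h.fst, fun v => (measurable_pi_apply v).comp h.snd⟩,
    fun h => h.1.prodMk (measurable_pi_iff.2 h.2)⟩

/-- Nodes and pull counts take countably many values. Evaluation at a random node, random count or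
random recursion depth is therefore measurable as soon as it is so for each fixed value. -/
lemma measurable_countable_comp {ι β : Type*} [Countable ι] [MeasurableSpace ι]
    [DiscreteMeasurableSpace ι] [MeasurableSpace β] {F : ι → Ω → β} {k : Ω → ι}
    (hF : ∀ i, Measurable (F i)) (hk : Measurable k) : Measurable fun ω => F (k ω) ω := by
  have : Measurable fun p : ι × Ω => F p.1 p.2 := measurable_from_prod_countable_right hF
  exact this.comp (hk.prodMk measurable_id)

variable {z : Ω → Node → ℕ → ℝ} {σ : Ω → State}

lemma measurable_empMean (hz : ∀ v j, Measurable fun ω => z ω v j) (v : Node) (T : ℕ) :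
    Measurable fun ω => empMean (z ω v) T := by
  unfold empMean
  have := hz v
  fun_prop

lemma measurable_empVar (hz : ∀ v j, Measurable fun ω => z ω v j) (v : Node) (T : ℕ) :
    Measurable fun ω => empVar (z ω v) T := by
  unfold empVar
  have := hz v
  have := measurable_empMean hz v T
  fun_prop

lemma measurableSet_isLeaf (hσ : Measurable σ) (v : Node) :
    MeasurableSet {ω | (σ ω).IsLeaf v} :=
  (measurable_state_iff.1 hσ).1
    (MeasurableSet.of_discrete (s := {F : Finset Node | false :: v ∉ F ∧ true :: v ∉ F}))

lemma measurable_tau (A : Params) (hz : ∀ v j, Measurable fun ω => z ω v j) (t : ℕ)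
    (hσ : Measurable σ) (v : Node) : Measurable fun ω => tau A (z ω) t (σ ω) v := by
  have h := measurable_countable_comp (measurable_empVar hz v) ((measurable_state_iff.1 hσ).2 v)
  unfold tau threshold
  fun_prop

lemma measurable_uVal (A : Params) (hz : ∀ v j, Measurable fun ω => z ω v j) (t : ℕ)
    (hσ : Measurable σ) (v : Node) : Measurable fun ω => uVal A (z ω) t (σ ω) v := by
  have hp := (measurable_state_iff.1 hσ).2 v
  have h := measurable_countable_comp (measurable_empVar hz v) hp
  have h' := measurable_countable_comp (measurable_empMean hz v) hp
  have hp' : Measurable fun ω => ((σ ω).pulls v : ℝ) := (Measurable.of_discrete).comp hp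
  unfold uVal
  refine Measurable.ite (hp (measurableSet_singleton 0)) measurable_const ?_
  refine measurable_coe_real_ereal.comp ?_
  unfold statErr
  fun_prop

lemma measurable_bVal (A : Params) (hz : ∀ v j, Measurable fun ω => z ω v j) (t : ℕ)
    (hσ : Measurable σ) (v : Node) : Measurable fun ω => bVal A (z ω) t (σ ω) v := by
  have hb : ∀ k v, Measurable fun ω => bAux A (z ω) t (σ ω) k v := by
    intro k
    induction k with
    | zero => exact measurable_uVal A hz t hσ
    | succ k ih =>
      intro v
      unfold bAux
      exact Measurable.ite (measurableSet_isLeaf hσ v) (measurable_uVal A hz t hσ v)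
        ((measurable_uVal A hz t hσ v).min ((ih _).max (ih _)))
  unfold bVal
  exact measurable_countable_comp (F := fun k ω => bAux A (z ω) t (σ ω) k v) (fun k => hb k v)
    ((Measurable.of_discrete (f := fun F : Finset Node => F.sup List.length - v.length)).comp
      (measurable_state_iff.1 hσ).1)

lemma measurable_bestChild (A : Params) (hz : ∀ v j, Measurable fun ω => z ω v j) (t : ℕ)
    (hσ : Measurable σ) (v : Node) : Measurable fun ω => bestChild A (z ω) t (σ ω) v := by
  have h := measurable_bVal A hz t hσ
  unfold bestChild
  exact Measurable.ite (measurableSet_lt (h _) (h _)) measurable_const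
    (Measurable.ite (measurableSet_lt (h _) (h _)) measurable_const measurable_const)

lemma measurable_select (A : Params) (hz : ∀ v j, Measurable fun ω => z ω v j) (t : ℕ)
    (hσ : Measurable σ) : Measurable fun ω => select A (z ω) t (σ ω) := by
  have hp' : ∀ v, Measurable fun ω => ((σ ω).pulls v : ℝ) := fun v =>
    (Measurable.of_discrete).comp ((measurable_state_iff.1 hσ).2 v)
  have hd : ∀ k v, Measurable fun ω => descend A (z ω) t (σ ω) k v := by
    intro k
    induction k with
    | zero => exact fun v => measurable_const
    | succ k ih =>
      intro v
      unfold descend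
      refine Measurable.ite ?_ ?_ measurable_const
      · refine (measurableSet_isLeaf hσ v).compl.inter ?_
        exact (MeasurableSet.const (v = [])).union
          (measurableSet_le (measurable_tau A hz t hσ v) (hp' v))
      · exact measurable_countable_comp (F := fun w ω => descend A (z ω) t (σ ω) k w) ih
          (measurable_bestChild A hz t hσ v)
  unfold select
  exact measurable_countable_comp (F := fun k ω => descend A (z ω) t (σ ω) k []) (fun k => hd k [])
    ((Measurable.of_discrete (f := fun F : Finset Node => F.sup List.length)).comp
      (measurable_state_iff.1 hσ).1)

lemma measurable_step (A : Params) (hz : ∀ v j, Measurable fun ω => z ω v j) (t : ℕ)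
    (hσ : Measurable σ) : Measurable fun ω => step A (z ω) t (σ ω) := by
  classical
  have hpull : ∀ w, Measurable fun ω => (σ ω).pull w := by
    intro w
    obtain ⟨h1, h2⟩ := measurable_state_iff.1 hσ
    refine measurable_state_iff.2 ⟨h1, fun v => ?_⟩
    by_cases h : v = w
    · subst h
      simp only [State.pull, Function.update_self]
      exact (h2 v).add_const 1
    · simp only [State.pull, Function.update_of_ne h]
      exact h2 v
  have hexp : ∀ w, Measurable fun ω => ((σ ω).pull w).expand w := by
    intro w
    obtain ⟨h1, h2⟩ := measurable_state_iff.1 (hpull w)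
    exact measurable_state_iff.2 ⟨(Measurable.of_discrete
      (f := fun F : Finset Node => F ∪ {false :: w, true :: w})).comp h1, h2⟩
  unfold step
  refine measurable_countable_comp (F := fun w ω =>
    if ((σ ω).pull w).IsLeaf w ∧
      tau A (z ω) t ((σ ω).pull w) w ≤ ((σ ω).pull w).pulls w then ((σ ω).pull w).expand w
    else (σ ω).pull w) (fun w => ?_) (measurable_select A hz t hσ)
  refine Measurable.ite ?_ (hexp w) (hpull w)
  exact (measurableSet_isLeaf (hpull w) w).inter
    (measurableSet_le (measurable_tau A hz t (hpull w) w)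
      ((Measurable.of_discrete).comp ((measurable_state_iff.1 (hpull w)).2 w)))

lemma measurable_state (A : Params) (hz : ∀ v j, Measurable fun ω => z ω v j) (t : ℕ) :
    Measurable fun ω => state A (z ω) t := by
  induction t with
  | zero => exact measurable_const
  | succ t ih => exact measurable_step A hz (t + 1) ih

lemma measurable_pulled (A : Params) (hz : ∀ v j, Measurable fun ω => z ω v j) (t : ℕ) :
    Measurable fun ω => pulled A (z ω) t :=
  measurable_select A hz (t + 1) (measurable_state A hz t)

lemma measurable_pullIdx (A : Params) (hz : ∀ v j, Measurable fun ω => z ω v j) (t : ℕ) :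
    Measurable fun ω => pullIdx A (z ω) t :=
  measurable_countable_comp (F := fun w ω => (state A (z ω) t).pulls w)
    (measurable_state_iff.1 (measurable_state A hz t)).2 (measurable_pulled A hz t)

lemma measurable_received (A : Params) (hz : ∀ v j, Measurable fun ω => z ω v j) (t : ℕ) :
    Measurable fun ω => z ω (pulled A (z ω) t) (pullIdx A (z ω) t) :=
  measurable_countable_comp (F := fun w ω => z ω w (pullIdx A (z ω) t))
    (fun w => measurable_countable_comp (F := fun k ω => z ω w k) (hz w)
      (measurable_pullIdx A hz t)) (measurable_pulled A hz t)

lemma measurable_regret {X : Type*} (f : X → ℝ) (A : Params)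
    (hz : ∀ v j, Measurable fun ω => z ω v j) (n : ℕ) :
    Measurable fun ω => regret f A (z ω) n := by
  simp only [regret_eq]
  exact Finset.measurable_sum _ fun t _ => (measurable_received A hz t).const_sub _

end Measurability

/-! ### Concentration of the empirical mean and of the empirical variance -/

/-- For `u ≥ 0` the Taylor remainder is at most `u ^ 3 / 2`, and `(1 + u) (1 - a) ≤ 1`. For `u ≤ 0`
the quadratic lower bound for `exp (-u)` is inverted, using `(1 + u + u² / 2) (1 - u + u² / 2) = 1 +
u⁴ / 4`. -/
lemma exp_le_one_add_add_sq {u a : ℝ} (hu : |u| ≤ a) (ha : a < 1) :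
    Real.exp u ≤ 1 + u + u ^ 2 / (2 * (1 - a)) := by
  have ha0 : 0 ≤ a := (abs_nonneg u).trans hu
  obtain ⟨hu1, hu2⟩ := abs_le.1 hu
  have hden : 0 < 2 * (1 - a) := by linarith
  rcases le_total 0 u with h | h
  · have h1 := Real.exp_bound' h (hu2.trans ha.le) (n := 3) (by norm_num)
    have h2 : u ^ 2 / 2 + u ^ 3 / 2 ≤ u ^ 2 / (2 * (1 - a)) := by
      rw [le_div_iff₀ hden]
      have : (1 + u) * (1 - a) ≤ 1 := by nlinarith
      have h3 : 0 ≤ u ^ 2 := sq_nonneg u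
      nlinarith
    have h3 : 0 ≤ u ^ 3 := by positivity
    norm_num [Finset.sum_range_succ, Nat.factorial] at h1
    linarith
  · have h1 := Real.quadratic_le_exp_of_nonneg (neg_nonneg.2 h)
    have h2 : Real.exp u * Real.exp (-u) = 1 := by rw [← Real.exp_add]; simp
    have h3 : Real.exp u ≤ 1 + u + u ^ 2 / 2 := by
      have h4 := Real.exp_pos u
      have h5 : 0 < 1 + u + u ^ 2 / 2 := by nlinarith [sq_nonneg (u + 1)]
      by_contra hc
      push Not at hc
      have h6 : 1 ≤ (1 + u + u ^ 2 / 2) * (1 + -u + (-u) ^ 2 / 2) := by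
        nlinarith [sq_nonneg (u ^ 2)]
      have h7 : (1 + u + u ^ 2 / 2) * (1 + -u + (-u) ^ 2 / 2) <
          Real.exp u * Real.exp (-u) :=
        mul_lt_mul hc h1 (by nlinarith [sq_nonneg u]) h4.le
      linarith
    have h8 : u ^ 2 / 2 ≤ u ^ 2 / (2 * (1 - a)) := by
      gcongr
      linarith
    linarith

lemma exp_neg_le_one_sub_add_sq {u : ℝ} (hu : 0 ≤ u) : Real.exp (-u) ≤ 1 - u + u ^ 2 / 2 := by
  have h1 := Real.quadratic_le_exp_of_nonneg hu
  have h2 : Real.exp (-u) * Real.exp u = 1 := by rw [← Real.exp_add]; simp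
  by_contra hc
  push Not at hc
  have h6 : 1 ≤ (1 - u + u ^ 2 / 2) * (1 + u + u ^ 2 / 2) := by nlinarith [sq_nonneg (u ^ 2)]
  have h7 : (1 - u + u ^ 2 / 2) * (1 + u + u ^ 2 / 2) < Real.exp (-u) * Real.exp u :=
    mul_lt_mul hc h1 (by positivity) (Real.exp_pos _).le
  linarith

section Concentration

variable {Ω : Type*} [MeasurableSpace Ω] {μ : Measure Ω} [IsProbabilityMeasure μ]

lemma integrable_of_abs_le {Z : Ω → ℝ} (hZ : Measurable Z) {M : ℝ} (hM : ∀ᵐ ω ∂μ, |Z ω| ≤ M) :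
    Integrable Z μ :=
  Integrable.of_bound hZ.aestronglyMeasurable M hM

lemma integrable_sq_of_abs_le {Z : Ω → ℝ} (hZ : Measurable Z) {M : ℝ}
    (hM : ∀ᵐ ω ∂μ, |Z ω| ≤ M) : Integrable (fun ω => Z ω ^ 2) μ := by
  refine integrable_of_abs_le (hZ.pow_const 2) (M := M ^ 2) ?_
  filter_upwards [hM] with ω h
  rw [abs_pow]
  gcongr

lemma integrable_exp_mul_of_abs_le {Z : Ω → ℝ} (hZ : Measurable Z) {M : ℝ}
    (hM : ∀ᵐ ω ∂μ, |Z ω| ≤ M) (t : ℝ) : Integrable (fun ω => Real.exp (t * Z ω)) μ :=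
  integrable_exp_mul_of_mem_Icc (a := -M) (b := M) hZ.aemeasurable
    (hM.mono fun _ h => abs_le.1 h)

lemma mgf_le_exp_of_abs_le {Z : Ω → ℝ} (hZ : Measurable Z) {M σ l : ℝ}
    (hM : ∀ᵐ ω ∂μ, |Z ω| ≤ M) (hmean : ∫ ω, Z ω ∂μ = 0) (hvar : ∫ ω, Z ω ^ 2 ∂μ = σ ^ 2)
    (hl : 0 ≤ l) (hlM : l * M < 1) :
    mgf Z μ l ≤ Real.exp (l ^ 2 * σ ^ 2 / (2 * (1 - l * M))) := by
  have hi1 := integrable_of_abs_le hZ hM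
  have hi2 := integrable_sq_of_abs_le hZ hM
  have hi3 : Integrable (fun ω => l ^ 2 / (2 * (1 - l * M)) * Z ω ^ 2) μ := hi2.const_mul _
  have hi4 : Integrable (fun ω => 1 + l * Z ω) μ := (integrable_const 1).add (hi1.const_mul l)
  calc mgf Z μ l ≤ ∫ ω, (1 + l * Z ω) + l ^ 2 / (2 * (1 - l * M)) * Z ω ^ 2 ∂μ := by
        refine integral_mono_ae (integrable_exp_mul_of_abs_le hZ hM l) (hi4.add hi3) ?_
        filter_upwards [hM] with ω h
        refine (exp_le_one_add_add_sq (u := l * Z ω) (a := l * M) ?_ hlM).trans (le_of_eq ?_)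
        · rw [abs_mul, abs_of_nonneg hl]
          gcongr
        · ring
    _ = 1 + l ^ 2 * σ ^ 2 / (2 * (1 - l * M)) := by
        rw [integral_add hi4 hi3, integral_add (integrable_const 1) (hi1.const_mul l),
          integral_const_mul, integral_const_mul, hmean, hvar]
        simp
        ring
    _ ≤ _ := by
        rw [add_comm]
        exact Real.add_one_le_exp _

lemma mgf_sq_neg_le_exp {Z : Ω → ℝ} (hZ : Measurable Z) {M σ l : ℝ}
    (hM : ∀ᵐ ω ∂μ, |Z ω| ≤ M) (hvar : ∫ ω, Z ω ^ 2 ∂μ = σ ^ 2) (hl : 0 ≤ l) :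
    mgf (fun ω => Z ω ^ 2) μ (-l) ≤
      Real.exp (-l * σ ^ 2 + l ^ 2 * M ^ 2 * σ ^ 2 / 2) := by
  have hM2 : ∀ᵐ ω ∂μ, |Z ω ^ 2| ≤ M ^ 2 := by
    filter_upwards [hM] with ω h
    rw [abs_pow]; gcongr
  have hi2 := integrable_sq_of_abs_le hZ hM
  calc mgf (fun ω => Z ω ^ 2) μ (-l)
      ≤ ∫ ω, 1 + (-l + l ^ 2 * M ^ 2 / 2) * Z ω ^ 2 ∂μ := by
        refine integral_mono_ae (integrable_exp_mul_of_abs_le (hZ.pow_const 2) hM2 (-l))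
          ((integrable_const 1).add (hi2.const_mul _)) ?_
        filter_upwards [hM2] with ω h
        have h0 : 0 ≤ Z ω ^ 2 := sq_nonneg _
        rw [abs_of_nonneg h0] at h
        have h1 := exp_neg_le_one_sub_add_sq (u := l * Z ω ^ 2) (by positivity)
        simp only [neg_mul]
        have h2 : (l * Z ω ^ 2) ^ 2 ≤ l ^ 2 * M ^ 2 * Z ω ^ 2 := by
          have h3 : Z ω ^ 2 * Z ω ^ 2 ≤ M ^ 2 * Z ω ^ 2 := by gcongr
          calc (l * Z ω ^ 2) ^ 2 = l ^ 2 * (Z ω ^ 2 * Z ω ^ 2) := by ring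
            _ ≤ l ^ 2 * (M ^ 2 * Z ω ^ 2) := by gcongr
            _ = _ := by ring
        linarith
    _ = (-l * σ ^ 2 + l ^ 2 * M ^ 2 * σ ^ 2 / 2) + 1 := by
        rw [integral_add (integrable_const 1) (hi2.const_mul _), integral_const_mul, hvar]
        simp
        ring
    _ ≤ _ := Real.add_one_le_exp _

/-- Chernoff bound for sums of independent variables, for either sign of `l`. -/
lemma measureReal_sum_le_exp {W : ℕ → Ω → ℝ} (hW : ∀ j, Measurable (W j)) (hind : iIndepFun W μ)
    {M l c : ℝ} (hM : ∀ j, ∀ᵐ ω ∂μ, |W j ω| ≤ M) (hc : ∀ j, mgf (W j) μ l ≤ Real.exp c)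
    (T : ℕ) (a : ℝ) :
    μ.real {ω | l * a ≤ l * ∑ j ∈ Finset.range T, W j ω} ≤ Real.exp (-(l * a) + T * c) := by
  have hsum : ∀ᵐ ω ∂μ, |(∑ j ∈ Finset.range T, W j) ω| ≤ T * M := by
    filter_upwards [ae_all_iff.2 hM] with ω h
    rw [Finset.sum_apply]
    refine (Finset.abs_sum_le_sum_abs _ _).trans ?_
    refine (Finset.sum_le_card_nsmul _ _ M fun j _ => h j).trans ?_
    simp
  have hms : Measurable (∑ j ∈ Finset.range T, W j) := by fun_prop
  have h1 := measure_ge_le_exp_mul_mgf (μ := μ) (X := fun ω => l * (∑ j ∈ Finset.range T, W j) ω)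
    (l * a) zero_le_one (by simpa using integrable_exp_mul_of_abs_le hms hsum l)
  have h2 : mgf (fun ω => l * (∑ j ∈ Finset.range T, W j) ω) μ 1 =
      mgf (∑ j ∈ Finset.range T, W j) μ l := by
    simp [mgf]
  rw [h2, hind.mgf_sum hW] at h1
  simp only [Finset.sum_apply] at h1
  refine h1.trans ?_
  rw [Real.exp_add, neg_one_mul]
  gcongr
  rw [Real.exp_nat_mul]
  calc ∏ j ∈ Finset.range T, mgf (W j) μ l ≤ ∏ j ∈ Finset.range T, Real.exp c :=
        Finset.prod_le_prod (fun _ _ => mgf_nonneg) fun j _ => hc j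
    _ = Real.exp c ^ T := by simp

variable {Z : ℕ → Ω → ℝ} {M σ : ℝ}

/-- Bernstein's inequality. -/
lemma measureReal_sum_ge_le (hZ : ∀ j, Measurable (Z j)) (hind : iIndepFun Z μ)
    (hM : ∀ j, ∀ᵐ ω ∂μ, |Z j ω| ≤ M) (hmean : ∀ j, ∫ ω, Z j ω ∂μ = 0)
    (hvar : ∀ j, ∫ ω, Z j ω ^ 2 ∂μ = σ ^ 2) (hM0 : 0 < M) (hσ : 0 < σ) {s : ℝ} (hs : 0 < s)
    (T : ℕ) :
    μ.real {ω | T * (√2 * σ * s + M * s ^ 2) ≤ ∑ j ∈ Finset.range T, Z j ω} ≤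
      Real.exp (-(T * s ^ 2)) := by
  have h2 := Real.sq_sqrt (show (0 : ℝ) ≤ 2 by norm_num)
  have h20 : 0 < √2 := Real.sqrt_pos.2 (by norm_num)
  have hden : 0 < σ + √2 * M * s := by positivity
  -- This choice makes the Chernoff exponent equal to `-(T * s ^ 2)`.
  set l := √2 * s / (σ + √2 * M * s) with hl
  have hl0 : 0 < l := by positivity
  have e1 : 1 - l * M = σ / (σ + √2 * M * s) := by
    rw [hl]; field_simp; ring
  have hlM : l * M < 1 := by
    have : 0 < 1 - l * M := by rw [e1]; positivity
    linarith
  have h := measureReal_sum_le_exp hZ hind hM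
    (fun j => mgf_le_exp_of_abs_le (hZ j) (hM j) (hmean j) (hvar j) hl0.le hlM) T
    (T * (√2 * σ * s + M * s ^ 2))
  have e2 : -(l * (T * (√2 * σ * s + M * s ^ 2))) +
      T * (l ^ 2 * σ ^ 2 / (2 * (1 - l * M))) = -(T * s ^ 2) := by
    rw [e1, hl]
    field_simp
    generalize √2 = r at *
    linear_combination (-(T * σ)) * h2
  rw [e2] at h
  refine le_trans (measureReal_mono fun ω hω => ?_) h
  exact mul_le_mul_of_nonneg_left hω hl0.le

lemma measureReal_sum_sq_le_le (hZ : ∀ j, Measurable (Z j)) (hind : iIndepFun Z μ)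
    (hM : ∀ j, ∀ᵐ ω ∂μ, |Z j ω| ≤ M)
    (hvar : ∀ j, ∫ ω, Z j ω ^ 2 ∂μ = σ ^ 2) (hM0 : 0 < M) (hσ : 0 < σ) {s : ℝ} (hs : 0 < s)
    (T : ℕ) :
    μ.real {ω | ∑ j ∈ Finset.range T, Z j ω ^ 2 ≤ T * (σ ^ 2 - √2 * M * σ * s)} ≤
      Real.exp (-(T * s ^ 2)) := by
  have h2 := Real.sq_sqrt (show (0 : ℝ) ≤ 2 by norm_num)
  have h20 : 0 < √2 := Real.sqrt_pos.2 (by norm_num)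
  -- The minimizer of `l ^ 2 M ^ 2 σ ^ 2 / 2 - √2 l M σ s`, the Chernoff exponent per sample.
  set l := √2 * s / (M * σ) with hl
  have hl0 : 0 < l := by positivity
  have hM2 : ∀ j, ∀ᵐ ω ∂μ, |Z j ω ^ 2| ≤ M ^ 2 := fun j => by
    filter_upwards [hM j] with ω h
    rw [abs_pow]; gcongr
  have h := measureReal_sum_le_exp (W := fun j ω => Z j ω ^ 2) (fun j => (hZ j).pow_const 2)
    (hind.comp (fun _ u => u ^ 2) fun _ => by fun_prop) hM2
    (fun j => mgf_sq_neg_le_exp (hZ j) (hM j) (hvar j) hl0.le) T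
    (T * (σ ^ 2 - √2 * M * σ * s))
  have e2 : -(-l * (T * (σ ^ 2 - √2 * M * σ * s))) +
      T * (-l * σ ^ 2 + l ^ 2 * M ^ 2 * σ ^ 2 / 2) = -(T * s ^ 2) := by
    rw [hl]
    field_simp
    generalize √2 = r at *
    linear_combination (-(T * s * M)) * h2
  rw [e2] at h
  refine le_trans (measureReal_mono fun ω hω => ?_) h
  exact mul_le_mul_of_nonpos_left hω (neg_nonpos.2 hl0.le)

end Concentration

/-- Replaces the true deviation `σ` in Bernstein's bound by the empirical one. With `D ^ 2 ≤ M D`,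
completing the square gives `σ ≤ √V + (√3 + √2) M s`, and the constant is `√6 + 2 + 1 ≤ 6`. -/
lemma abs_le_sqrt_mul_add {D V M σ s : ℝ} (hV : 0 ≤ V) (hM : 0 ≤ M) (hs : 0 ≤ s)
    (hD0 : 0 ≤ D) (hD : D ≤ √2 * σ * s + M * s ^ 2)
    (hσV : σ ^ 2 - √2 * M * σ * s ≤ V + D ^ 2) (hDM : D ≤ M) :
    D ≤ √2 * √V * s + 6 * M * s ^ 2 := by
  have h2 := Real.sq_sqrt (show (0 : ℝ) ≤ 2 by norm_num)
  have h20 : 0 ≤ √2 := Real.sqrt_nonneg 2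
  have hV2 := Real.sq_sqrt hV
  have hV0 := Real.sqrt_nonneg V
  have h3 := Real.sq_sqrt (show (0 : ℝ) ≤ 3 by norm_num)
  have h30 : 0 ≤ √3 := Real.sqrt_nonneg 3
  set r := √V
  have hMs : 0 ≤ M * s := mul_nonneg hM hs
  have h1 : D ^ 2 ≤ M * (√2 * σ * s + M * s ^ 2) := by
    calc D ^ 2 = D * D := sq D
      _ ≤ M * (√2 * σ * s + M * s ^ 2) := mul_le_mul hDM hD hD0 hM
  have h4 : (σ - √2 * (M * s)) ^ 2 ≤ (r + √3 * (M * s)) ^ 2 := by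
    have h5 : 0 ≤ 2 * r * √3 * (M * s) := by positivity
    have e1 : (σ - √2 * (M * s)) ^ 2 =
        σ ^ 2 - √2 * M * σ * s - √2 * M * σ * s + √2 ^ 2 * (M * s) ^ 2 := by ring
    have e2 : (r + √3 * (M * s)) ^ 2 = r ^ 2 + 2 * r * √3 * (M * s) + √3 ^ 2 * (M * s) ^ 2 := by
      ring
    rw [e1, e2, h2, h3, hV2]
    have e3 : M * (√2 * σ * s + M * s ^ 2) = √2 * M * σ * s + (M * s) ^ 2 := by ring
    linarith
  have h5 : σ - √2 * (M * s) ≤ r + √3 * (M * s) :=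
    (abs_le.1 (abs_le_of_sq_le_sq h4 (by positivity))).2
  have h6 : √2 * √3 ≤ 3 := by
    rw [← Real.sqrt_mul (by norm_num)]
    exact Real.sqrt_le_iff.2 ⟨by norm_num, by norm_num⟩
  have h7 : √2 * s * σ ≤ √2 * s * (r + √3 * (M * s) + √2 * (M * s)) := by
    gcongr; linarith
  have h8 : √2 * s * (r + √3 * (M * s) + √2 * (M * s)) =
      √2 * r * s + (√2 * √3) * (M * s ^ 2) + √2 ^ 2 * (M * s ^ 2) := by ring
  rw [h8, h2] at h7
  have h9 : 0 ≤ M * s ^ 2 := by positivity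
  nlinarith

/-- For small `s` the two corrections, `√2 M σ s` and `D ^ 2`, are at most `3 / 2` and `1` times `M
^ 2 s`, hence together at most `ε / 4`. -/
lemma half_le_of_small {D V M σ s ε : ℝ} (hM : 0 < M) (hσ : 0 ≤ σ) (hs : 0 ≤ s) (hσM : σ ≤ M)
    (hD0 : 0 ≤ D) (hD : D ≤ √2 * σ * s + M * s ^ 2)
    (hσV : σ ^ 2 - √2 * M * σ * s ≤ V + D ^ 2) (hε : ε ≤ σ ^ 2)
    (hsε : 10 * M ^ 2 * s ≤ ε) : ε / 2 ≤ V := by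
  have h2 : √2 ≤ 3 / 2 := Real.sqrt_le_iff.2 ⟨by norm_num, by norm_num⟩
  have h20 : 0 ≤ √2 := Real.sqrt_nonneg 2
  have hs1 : s ≤ 1 / 10 := by
    have h1 : ε ≤ M ^ 2 := hε.trans (by gcongr)
    have h3 : 0 < M ^ 2 := by positivity
    nlinarith
  have hMs : 0 ≤ M * s := by positivity
  have h3 : D ≤ 2 * (M * s) := by
    have h4 : √2 * σ * s ≤ 3 / 2 * M * s := by gcongr
    have h5 : M * s ^ 2 ≤ 1 / 10 * (M * s) := by nlinarith
    linarith
  have h4 : D ^ 2 ≤ M ^ 2 * s := by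
    calc D ^ 2 ≤ (2 * (M * s)) ^ 2 := by gcongr
      _ = 4 * s * (M ^ 2 * s) := by ring
      _ ≤ 1 * (M ^ 2 * s) := by gcongr; linarith
      _ = _ := one_mul _
  have h5 : √2 * M * σ * s ≤ 3 / 2 * M * M * s := by gcongr
  nlinarith

lemma empVar_add_sq (y : ℕ → ℝ) (m : ℝ) {T : ℕ} (hT : T ≠ 0) :
    empVar y T + (empMean y T - m) ^ 2 = (∑ j ∈ Finset.range T, (y j - m) ^ 2) / T := by
  have hT' : (T : ℝ) ≠ 0 := by exact_mod_cast hT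
  have h1 : ∑ j ∈ Finset.range T, y j = T * empMean y T := by
    unfold empMean; field_simp
  have h2 : ∑ j ∈ Finset.range T, (y j - m) ^ 2 =
      ∑ j ∈ Finset.range T, (y j - empMean y T) ^ 2 + T * (empMean y T - m) ^ 2 := by
    set e := empMean y T
    have : ∀ j, (y j - m) ^ 2 = (y j - e) ^ 2 + (2 * (e - m) * y j - (e ^ 2 - m ^ 2)
        - (e - m) * (e - m) + (e - m) * (e - m) - 2 * (e - m) * e + (e - m) * (e + m)
        + (e - m) ^ 2) := fun j => by ring
    simp only [this, Finset.sum_add_distrib, Finset.sum_sub_distrib, ← Finset.mul_sum, h1,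
      Finset.sum_const, Finset.card_range, nsmul_eq_mul]
    ring
  rw [h2, empVar]
  field_simp

lemma empVar_le_sq {y : ℕ → ℝ} {m b : ℝ} (h : ∀ j, |y j - m| ≤ b) (T : ℕ) :
    empVar y T ≤ b ^ 2 := by
  rcases eq_or_ne T 0 with rfl | hT
  · simp [empVar, sq_nonneg]
  have hT' : (0 : ℝ) < T := by exact_mod_cast Nat.pos_of_ne_zero hT
  have h1 := empVar_add_sq y m hT
  have h2 : (∑ j ∈ Finset.range T, (y j - m) ^ 2) / T ≤ b ^ 2 := by
    rw [div_le_iff₀ hT']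
    refine (Finset.sum_le_card_nsmul _ _ (b ^ 2) fun j _ => ?_).trans (by simp [mul_comm])
    rw [← sq_abs]
    gcongr
    exact h j
  nlinarith [sq_nonneg (empMean y T - m)]

lemma abs_empMean_sub_le {y : ℕ → ℝ} {m b : ℝ} (h : ∀ j, |y j - m| ≤ b) {T : ℕ} (hT : T ≠ 0) :
    |empMean y T - m| ≤ b := by
  have hT' : (0 : ℝ) < T := by exact_mod_cast Nat.pos_of_ne_zero hT
  have h1 : empMean y T - m = (∑ j ∈ Finset.range T, (y j - m)) / T := by
    rw [Finset.sum_sub_distrib, empMean]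
    simp
    field_simp
  rw [h1, abs_div, abs_of_pos hT', div_le_iff₀ hT']
  refine (Finset.abs_sum_le_sum_abs _ _).trans ?_
  exact (Finset.sum_le_card_nsmul _ _ b fun j _ => h j).trans (by simp [mul_comm])

section Confidence

variable {Ω : Type*} [MeasurableSpace Ω] {μ : Measure Ω} [IsProbabilityMeasure μ]

/-- An empirical Bernstein inequality. -/
lemma measureReal_not_confAt_le {X : ℕ → Ω → ℝ} {m b σ L ε : ℝ} (hX : ∀ j, Measurable (X j))
    (hind : iIndepFun X μ) (hb : ∀ j, ∀ᵐ ω ∂μ, |X j ω - m| ≤ b / 2)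
    (hmean : ∀ j, ∫ ω, X j ω ∂μ = m) (hvar : ∀ j, ∫ ω, (X j ω - m) ^ 2 ∂μ = σ ^ 2)
    (hb0 : 0 < b) (hσ : 0 < σ) (hL : 0 < L) (hε : 0 < ε) (hεσ : ε ≤ σ ^ 2) {T : ℕ} (hT : 1 ≤ T) :
    μ.real {ω | ¬ ConfAt (fun j => X j ω) m b L (57 * b ^ 4 / ε ^ 2) ε T} ≤
      3 * Real.exp (-(9 * L)) := by
  have hT0 : T ≠ 0 := by omega
  have hT' : (0 : ℝ) < T := by exact_mod_cast hT
  set M := b / 2 with hM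
  have hM0 : 0 < M := by positivity
  set s := √(9 * L / T) with hs
  have hs0 : 0 < s := Real.sqrt_pos.2 (by positivity)
  have hs2 : s ^ 2 = 9 * L / T := Real.sq_sqrt (by positivity)
  have hTs : T * s ^ 2 = 9 * L := by rw [hs2]; field_simp
  have hZ : ∀ j, Measurable fun ω => X j ω - m := fun j => (hX j).sub_const m
  have hXi : ∀ j, Integrable (X j) μ := fun j => by
    refine integrable_of_abs_le (hX j) (M := |m| + b / 2) ?_
    filter_upwards [hb j] with ω h
    have := abs_add_le m (X j ω - m)
    rw [add_sub_cancel] at this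
    linarith
  have hZind : iIndepFun (fun j ω => X j ω - m) μ :=
    hind.comp (fun _ u => u - m) fun _ => by fun_prop
  have hZmean : ∀ j, ∫ ω, (X j ω - m) ∂μ = 0 := fun j => by
    rw [integral_sub (hXi j) (integrable_const m), hmean]; simp
  have hσM : σ ≤ M := by
    have h1 : σ ^ 2 ≤ M ^ 2 := by
      rw [← hvar 0]
      have : ∫ ω, (X 0 ω - m) ^ 2 ∂μ ≤ ∫ _, M ^ 2 ∂μ := by
        refine integral_mono_ae (integrable_sq_of_abs_le (hZ 0) (hb 0)) (integrable_const _) ?_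
        filter_upwards [hb 0] with ω h
        rw [← sq_abs]
        gcongr
      simpa using this
    exact abs_le_of_sq_le_sq' h1 hM0.le |>.2
  have hA := measureReal_sum_ge_le hZ hZind hb hZmean hvar hM0 hσ hs0 T
  have hA' := measureReal_sum_ge_le (Z := fun j ω => -(X j ω - m)) (fun j => (hZ j).neg)
    (hZind.comp (fun _ u => -u) fun _ => by fun_prop)
    (fun j => by simpa only [abs_neg] using hb j)
    (fun j => by rw [integral_neg, hZmean, neg_zero])
    (fun j => by simpa only [neg_sq] using hvar j) hM0 hσ hs0 T
  have hB := measureReal_sum_sq_le_le hZ hZind hb hvar hM0 hσ hs0 T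
  rw [hTs] at hA hA' hB
  set EA := {ω | T * (√2 * σ * s + M * s ^ 2) ≤ ∑ j ∈ Finset.range T, (X j ω - m)}
  set EA' := {ω | T * (√2 * σ * s + M * s ^ 2) ≤ ∑ j ∈ Finset.range T, -(X j ω - m)}
  set EB := {ω | ∑ j ∈ Finset.range T, (X j ω - m) ^ 2 ≤ T * (σ ^ 2 - √2 * M * σ * s)}
  have hsub : {ω | ¬ ConfAt (fun j => X j ω) m b L (57 * b ^ 4 / ε ^ 2) ε T} ≤ᵐ[μ]
      ((EA ∪ EA') ∪ EB : Set Ω) := by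
    filter_upwards [ae_all_iff.2 hb] with ω hω hbad
    by_contra hgood
    apply hbad
    change ¬ (ω ∈ (EA ∪ EA') ∪ EB) at hgood
    simp only [Set.mem_union, not_or] at hgood
    obtain ⟨⟨h1, h2⟩, h3⟩ := hgood
    simp only [EA, EA', EB, Set.mem_ofPred_eq, not_le] at h1 h2 h3
    have e1 : ∑ j ∈ Finset.range T, (X j ω - m) = T * (empMean (fun j => X j ω) T - m) := by
      rw [Finset.sum_sub_distrib, empMean]
      simp
      field_simp
    rw [e1] at h1
    rw [Finset.sum_neg_distrib, e1, ← mul_neg] at h2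
    have h1' := lt_of_mul_lt_mul_left h1 hT'.le
    have h2' := lt_of_mul_lt_mul_left h2 hT'.le
    have hD : |empMean (fun j => X j ω) T - m| ≤ √2 * σ * s + M * s ^ 2 :=
      abs_le.2 ⟨by linarith, h1'.le⟩
    have hV := empVar_add_sq (fun j => X j ω) m hT0
    have hVB : σ ^ 2 - √2 * M * σ * s ≤
        empVar (fun j => X j ω) T + |empMean (fun j => X j ω) T - m| ^ 2 := by
      rw [sq_abs, hV, le_div_iff₀ hT']
      linarith
    have hDM : |empMean (fun j => X j ω) T - m| ≤ M := abs_empMean_sub_le hω hT0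
    have hV0 := empVar_nonneg (fun j => X j ω) T
    set D := |empMean (fun j => X j ω) T - m|
    set V := empVar (fun j => X j ω) T
    refine ⟨?_, fun hκ => ?_⟩
    · refine (abs_le_sqrt_mul_add hV0 hM0.le hs0.le (abs_nonneg _) hD hVB hDM).trans ?_
      unfold statErr
      apply le_of_eq
      congr 1
      · rw [hs, ← Real.sqrt_mul (by norm_num), ← Real.sqrt_mul (by positivity),
          ← Real.sqrt_sq (show (0 : ℝ) ≤ 3 by norm_num), ← Real.sqrt_mul (by positivity)]
        congr 1
        ring
      · rw [hs2, hM]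
        ring
    · refine half_le_of_small hM0 hσ.le hs0.le hσM (abs_nonneg _) hD hVB hεσ ?_
      -- With `M = b / 2` and `s ^ 2 = 9 L / T` the left side is `56.25 b ^ 4 L / T`, whence the
      -- constant `57`.
      have h4 : (10 * M ^ 2 * s) ^ 2 ≤ ε ^ 2 := by
        rw [mul_pow, hs2]
        have h5 : 57 * b ^ 4 * L ≤ T * ε ^ 2 := by
          have h6 := mul_le_mul_of_nonneg_right hκ (sq_nonneg ε)
          have h7 : 57 * b ^ 4 / ε ^ 2 * L * ε ^ 2 = 57 * b ^ 4 * L := by field_simp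
          rwa [h7] at h6
        have h8 : 0 ≤ b ^ 4 * L := by positivity
        rw [hM, mul_div_assoc', div_le_iff₀ hT']
        nlinarith
      exact abs_le_of_sq_le_sq' h4 hε.le |>.2
  calc _ ≤ μ.real ((EA ∪ EA') ∪ EB) := ENNReal.toReal_mono (measure_ne_top _ _) (measure_mono_ae hsub)
    _ ≤ μ.real EA + μ.real EA' + μ.real EB := by
        refine (measureReal_union_le _ _).trans ?_
        gcongr
        exact measureReal_union_le _ _
    _ ≤ _ := by linarith

end Confidence

/-! ### The rewards that are still to come are independent of the past -/

/-- The rewards of the node `v` from the number `k` on are replaced by zero. -/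
def trunc (v : Node) (k : ℕ) (z : Node → ℕ → ℝ) : Node → ℕ → ℝ :=
  fun w j => if w = v ∧ k ≤ j then 0 else z w j

/-- Two families of rewards agree as far as they are used in the first `t` rounds. -/
def AgreeAt (A : Params) (t : ℕ) (z z' : Node → ℕ → ℝ) : Prop :=
  ∀ w, ∀ j < (state A z t).pulls w, z w j = z' w j

lemma AgreeAt.mono {A : Params} {s t : ℕ} {z z' : Node → ℕ → ℝ} (h : AgreeAt A t z z')
    (hst : s ≤ t) : AgreeAt A s z z' :=
  fun w j hj => h w j (hj.trans_le (state_pulls_mono A z w hst))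

lemma AgreeAt.pulled_eq {A : Params} {t : ℕ} {z z' : Node → ℕ → ℝ} (h : AgreeAt A t z z') :
    pulled A z t = pulled A z' t := pulled_congr A t h

lemma AgreeAt.pullIdx_eq {A : Params} {t : ℕ} {z z' : Node → ℕ → ℝ} (h : AgreeAt A t z z') :
    pullIdx A z t = pullIdx A z' t := by
  rw [pullIdx, pullIdx, ← h.pulled_eq, state_congr A t h]

lemma agreeAt_trunc {A : Params} {t : ℕ} (z : Node → ℕ → ℝ) :
    AgreeAt A t z (trunc (pulled A z t) (pullIdx A z t) z) := by
  intro w j hj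
  unfold trunc
  rw [if_neg]
  rintro ⟨rfl, h⟩
  exact absurd hj (not_lt.2 h)

/-- Together with `agreeAt_trunc`, this shows that the event that `v` is pulled next with `k`
earlier pulls can be read off from the truncated rewards. -/
lemma trunc_agreeAt {A : Params} {t : ℕ} {z : Node → ℕ → ℝ} {v : Node} {k : ℕ}
    (hv : pulled A (trunc v k z) t = v) (hk : pullIdx A (trunc v k z) t = k) :
    AgreeAt A t (trunc v k z) z := by
  intro w j hj
  unfold trunc
  rw [if_neg]
  rintro ⟨rfl, h⟩
  rw [pullIdx, hv] at hk
  omega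

section Adapted

variable {Ω : Type*} [MeasurableSpace Ω] {μ : Measure Ω} {Y : Node → ℕ → Ω → ℝ}

lemma measurable_pi_of_forall {Ω' : Type*} {m : MeasurableSpace Ω'} {y : Ω' → ℕ → ℝ}
    (hy : ∀ j, Measurable fun ω => y ω j) : Measurable y :=
  measurable_pi_iff.2 hy

lemma measurable_trunc {Ω' : Type*} {m : MeasurableSpace Ω'} {z : Ω' → Node → ℕ → ℝ} {v : Node}
    {k : ℕ} (hz : ∀ w j, ¬ (w = v ∧ k ≤ j) → Measurable fun ω => z ω w j) :
    Measurable fun ω => trunc v k (z ω) := by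
  refine measurable_pi_iff.2 fun w => measurable_pi_iff.2 fun j => ?_
  unfold trunc
  split_ifs with h
  · exact measurable_const
  · exact hz w j h

lemma indepFun_trunc (hY : ∀ v j, Measurable (Y v j))
    (hind : iIndepFun (fun p : Node × ℕ => Y p.1 p.2) μ) (v : Node) (k : ℕ) :
    IndepFun (fun ω => trunc v k fun w j => Y w j ω) (fun ω j => Y v (k + j) ω) μ := by
  let S : Set (Node × ℕ) := {p | ¬ (p.1 = v ∧ k ≤ p.2)}
  have h := indep_iSup_of_disjoint (fun p : Node × ℕ => (hY p.1 p.2).comap_le) hind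
    (disjoint_compl_right (a := S))
  have hle : ∀ (R : Set (Node × ℕ)) (p : Node × ℕ), p ∈ R →
      Measurable[⨆ p ∈ R, MeasurableSpace.comap (Y p.1 p.2) inferInstance] (Y p.1 p.2) :=
    fun R p hp => Measurable.of_comap_le (le_iSup₂_of_le p hp le_rfl)
  refine indep_of_indep_of_le_left (indep_of_indep_of_le_right h ?_) ?_
  · exact measurable_iff_comap_le.1 (measurable_pi_of_forall fun j => hle _ (v, k + j) (by simp [S]))
  · exact measurable_iff_comap_le.1 (measurable_trunc fun w j hp => hle _ (w, j) hp)

lemma measurable_eval (v : Node) (j : ℕ) : Measurable fun z : Node → ℕ → ℝ => z v j :=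
  (measurable_pi_apply j).comp (measurable_pi_apply v)

/-- The rewards of the pulled node that are still to come are independent of the past. -/
lemma lintegral_pulled_le [IsProbabilityMeasure μ] (A : Params) (hY : ∀ v j, Measurable (Y v j))
    (hind : iIndepFun (fun p : Node × ℕ => Y p.1 p.2) μ) (t : ℕ)
    {F : (Node → ℕ → ℝ) → ℝ≥0∞} (hF : Measurable F)
    (hFt : ∀ z z', AgreeAt A t z z' → F z = F z')
    {G : Node → ℕ → (ℕ → ℝ) → ℝ≥0∞} (hG : ∀ v k, Measurable (G v k)) {c : ℝ≥0∞}
    (hGc : ∀ v k, ∫⁻ ω, G v k (fun j => Y v (k + j) ω) ∂μ ≤ c) :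
    ∫⁻ ω, F (fun v j => Y v j ω) *
        G (pulled A (fun v j => Y v j ω) t) (pullIdx A (fun v j => Y v j ω) t)
          (fun j => Y (pulled A (fun v j => Y v j ω) t)
            (pullIdx A (fun v j => Y v j ω) t + j) ω) ∂μ ≤
      c * ∫⁻ ω, F (fun v j => Y v j ω) ∂μ := by
  have hYz : Measurable fun ω => fun v j => Y v j ω :=
    measurable_pi_iff.2 fun v => measurable_pi_iff.2 fun j => hY v j
  have hpull := measurable_pulled A (z := fun z : Node → ℕ → ℝ => z) measurable_eval t
  have hidx := measurable_pullIdx A (z := fun z : Node → ℕ → ℝ => z) measurable_eval t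
  let E : Node × ℕ → Set (Node → ℕ → ℝ) := fun q => {z | pulled A z t = q.1 ∧ pullIdx A z t = q.2}
  have hE : ∀ q, MeasurableSet (E q) := fun q =>
    (hpull (measurableSet_singleton q.1)).inter (hidx (measurableSet_singleton q.2))
  let B : Node × ℕ → Set Ω := fun q => (fun ω => fun v j => Y v j ω) ⁻¹' E q
  have hB : ∀ q, MeasurableSet (B q) := fun q => hYz (hE q)
  have hdisj : Pairwise (Function.onFun Disjoint B) := by
    intro q q' hqq'
    refine Set.disjoint_left.2 fun ω h h' => hqq' ?_
    exact Prod.ext (h.1.symm.trans h'.1) (h.2.symm.trans h'.2)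
  have hcover : ⋃ q, B q = Set.univ := by
    refine Set.eq_univ_of_forall fun ω => Set.mem_iUnion.2 ?_
    exact ⟨(pulled A (fun v j => Y v j ω) t, pullIdx A (fun v j => Y v j ω) t), rfl, rfl⟩
  rw [← setLIntegral_univ, ← setLIntegral_univ (fun ω => F (fun v j => Y v j ω)), ← hcover,
    lintegral_iUnion hB hdisj, lintegral_iUnion hB hdisj, ← ENNReal.tsum_mul_left]
  refine ENNReal.tsum_le_tsum fun q => ?_
  -- On the event `E q` the pulled node and its index are fixed. Both the event and `F` are
  -- unaffected by truncation, so `F'` is independent of the tail seen by `G`.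
  let F' := (E q).indicator F
  have hF' : Measurable F' := hF.indicator (hE q)
  have hF't : ∀ z, F' (trunc q.1 q.2 z) = F' z := by
    intro z
    by_cases hz : z ∈ E q
    · have h1 := agreeAt_trunc (A := A) (t := t) z
      rw [hz.1, hz.2] at h1
      have hz' : trunc q.1 q.2 z ∈ E q :=
        ⟨h1.pulled_eq.symm.trans hz.1, h1.pullIdx_eq.symm.trans hz.2⟩
      simp only [F', Set.indicator_of_mem hz, Set.indicator_of_mem hz', hFt _ _ h1]
    · have hz' : trunc q.1 q.2 z ∉ E q := by
        intro h
        have h1 := trunc_agreeAt h.1 h.2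
        exact hz ⟨h1.pulled_eq.symm.trans h.1, h1.pullIdx_eq.symm.trans h.2⟩
      simp only [F', Set.indicator_of_notMem hz, Set.indicator_of_notMem hz']
  have hindq := indepFun_trunc hY hind q.1 q.2
  have htail : Measurable fun ω => fun j => Y q.1 (q.2 + j) ω :=
    measurable_pi_iff.2 fun j => hY _ _
  have htr : Measurable fun ω => trunc q.1 q.2 fun w j => Y w j ω :=
    measurable_trunc fun w j _ => hY w j
  have hprod := lintegral_mul_eq_lintegral_mul_lintegral_of_indepFun'' (μ := μ)
    (hF'.comp htr).aemeasurable ((hG q.1 q.2).comp htail).aemeasurable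
    (hindq.comp hF' (hG q.1 q.2))
  simp only [Function.comp_apply, hF't] at hprod
  have e1 : ∫⁻ ω in B q, F (fun v j => Y v j ω) ∂μ = ∫⁻ ω, F' (fun v j => Y v j ω) ∂μ := by
    rw [← lintegral_indicator (hB q)]
    rfl
  calc _ = ∫⁻ ω in B q, F' (fun v j => Y v j ω) *
          G q.1 q.2 (fun j => Y q.1 (q.2 + j) ω) ∂μ := by
        refine setLIntegral_congr_fun (hB q) fun ω hω => ?_
        have h1 : F' (fun v j => Y v j ω) = F (fun v j => Y v j ω) :=
          Set.indicator_of_mem (s := E q) hω F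
        obtain ⟨h2, h3⟩ := hω
        simp only [h1, h2, h3]
    _ ≤ ∫⁻ ω, F' (fun v j => Y v j ω) * G q.1 q.2 (fun j => Y q.1 (q.2 + j) ω) ∂μ :=
        setLIntegral_le_lintegral _ _
    _ = (∫⁻ ω, F' (fun v j => Y v j ω) ∂μ) * ∫⁻ ω, G q.1 q.2 (fun j => Y q.1 (q.2 + j) ω) ∂μ :=
        hprod
    _ ≤ _ := by
        rw [e1, mul_comm]
        gcongr
        exact hGc _ _

/-- If every node has a bad sequence of rewards with probability at most `p`, then a node with a
bad sequence of rewards is pulled in the first `n` rounds with probability at most `n * p`. -/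
lemma measure_exists_pulled_le [IsProbabilityMeasure μ] (A : Params)
    (hY : ∀ v j, Measurable (Y v j)) (hind : iIndepFun (fun p : Node × ℕ => Y p.1 p.2) μ)
    {B : Node → Set (ℕ → ℝ)} (hB : ∀ v, MeasurableSet (B v)) {p : ℝ≥0∞}
    (hp : ∀ v, μ {ω | (fun j => Y v j ω) ∈ B v} ≤ p) (n : ℕ) :
    μ {ω | ∃ v, 0 < (state A (fun v j => Y v j ω) n).pulls v ∧ (fun j => Y v j ω) ∈ B v} ≤
      n * p := by
  -- Only first pulls are charged: at index `0` the tail is the whole reward sequence of the node.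
  let G : Node → ℕ → (ℕ → ℝ) → ℝ≥0∞ := fun v k => if k = 0 then (B v).indicator 1 else 0
  have hG : ∀ v k, Measurable (G v k) := fun v k => by
    simp only [G]
    split_ifs
    · exact measurable_one.indicator (hB v)
    · exact measurable_const
  have hGp : ∀ v k, ∫⁻ ω, G v k (fun j => Y v (k + j) ω) ∂μ ≤ p := by
    intro v k
    by_cases hk : k = 0
    · subst hk
      simp only [G, if_true, zero_add]
      have hm : MeasurableSet {ω | (fun j => Y v j ω) ∈ B v} :=
        (measurable_pi_iff.2 fun j => hY v j : Measurable fun ω => fun j => Y v j ω) (hB v)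
      refine le_trans (le_of_eq ?_) (hp v)
      rw [← lintegral_indicator_one hm]
      rfl
    · simp [G, hk]
  let E : ℕ → Set Ω := fun t => {ω | pullIdx A (fun v j => Y v j ω) t = 0 ∧
    (fun j => Y (pulled A (fun v j => Y v j ω) t) j ω) ∈ B (pulled A (fun v j => Y v j ω) t)}
  have hE : ∀ t, μ (E t) ≤ p := by
    intro t
    have h := lintegral_pulled_le A hY hind t (F := fun _ => 1) measurable_const
      (fun _ _ _ => rfl) hG hGp
    simp only [one_mul, lintegral_one, measure_univ, mul_one] at h
    refine le_trans ?_ h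
    refine meas_le_lintegral₀ (Measurable.aemeasurable ?_) fun ω hω => ?_
    · exact measurable_countable_comp
        (F := fun v ω => G v (pullIdx A (fun v j => Y v j ω) t)
          fun j => Y v (pullIdx A (fun v j => Y v j ω) t + j) ω)
        (fun v => measurable_countable_comp (F := fun k ω => G v k fun j => Y v (k + j) ω)
          (fun k => (hG v k).comp (measurable_pi_iff.2 fun j => hY v (k + j)))
          (measurable_pullIdx A hY t)) (measurable_pulled A hY t)
    · obtain ⟨h0, h1⟩ := hω
      simp only [G, h0, if_true, zero_add]
      rw [Set.indicator_of_mem h1]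
      simp
  calc _ ≤ μ (⋃ t ∈ Finset.range n, E t) := by
        refine measure_mono ?_
        rintro ω ⟨v, hv, hvB⟩
        obtain ⟨t, htn, ht, ht0⟩ := exists_first_pull A _ n v hv
        refine Set.mem_biUnion (Finset.mem_coe.2 (Finset.mem_range.2 htn)) ⟨ht0, ?_⟩
        rw [ht]
        exact hvB
    _ ≤ ∑ t ∈ Finset.range n, μ (E t) := measure_biUnion_finset_le _ _
    _ ≤ ∑ t ∈ Finset.range n, p := Finset.sum_le_sum fun t _ => hE t
    _ = n * p := by simp

/-- The Azuma-Hoeffding inequality for the received rewards. -/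
lemma measure_sum_sub_received_ge_le [IsProbabilityMeasure μ] (A : Params)
    (hY : ∀ v j, Measurable (Y v j)) (hind : iIndepFun (fun p : Node × ℕ => Y p.1 p.2) μ)
    {g : Node → ℝ} (hmem : ∀ v j, ∀ᵐ ω ∂μ, Y v j ω ∈ Set.Icc (0 : ℝ) 1)
    (hmean : ∀ v j, ∫ ω, Y v j ω ∂μ = g v) {n : ℕ} (hn : 0 < n) {a : ℝ} (ha : 0 ≤ a) :
    μ {ω | a ≤ ∑ t ∈ Finset.range n, (g (pulled A (fun v j => Y v j ω) t) -
      Y (pulled A (fun v j => Y v j ω) t) (pullIdx A (fun v j => Y v j ω) t) ω)} ≤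
      ENNReal.ofReal (Real.exp (-(2 * a ^ 2 / n))) := by
  let D : ℕ → (Node → ℕ → ℝ) → ℝ := fun t z => ∑ s ∈ Finset.range t,
    (g (pulled A z s) - z (pulled A z s) (pullIdx A z s))
  have hDm : ∀ t, Measurable (D t) := fun t => Finset.measurable_sum _ fun s _ =>
    ((Measurable.of_discrete (f := g)).comp
      (measurable_pulled A (z := fun z : Node → ℕ → ℝ => z) measurable_eval s)).sub
      (measurable_received A (z := fun z : Node → ℕ → ℝ => z) measurable_eval s)
  have hDt : ∀ t z z', AgreeAt A t z z' → D t z = D t z' := by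
    intro t z z' h
    refine Finset.sum_congr rfl fun s hs => ?_
    have hs' := Finset.mem_range.1 hs
    have h1 := h.mono hs'.le
    rw [← h1.pulled_eq, ← h1.pullIdx_eq, h _ _ (pullIdx_lt_pulls A z hs')]
  -- The minimizer of `n l ^ 2 / 8 - l a`.
  set l : ℝ := 4 * a / n with hl
  have hn' : (0 : ℝ) < n := by exact_mod_cast hn
  have hl0 : 0 ≤ l := by positivity
  have hmgf : ∀ v j, ∫⁻ ω, ENNReal.ofReal (Real.exp (l * (g v - Y v j ω))) ∂μ ≤
      ENNReal.ofReal (Real.exp (l ^ 2 / 8)) := by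
    intro v j
    have h1 := hasSubgaussianMGF_of_mem_Icc (hY v j).aemeasurable (hmem v j)
    have h2 := h1.mgf_le (-l)
    have h3 := h1.integrable_exp_mul (-l)
    rw [hmean] at h2 h3
    have e : ∀ ω, l * (g v - Y v j ω) = -l * (Y v j ω - g v) := fun ω => by ring
    simp only [e]
    rw [← ofReal_integral_eq_lintegral_ofReal h3 (ae_of_all _ fun ω => (Real.exp_pos _).le)]
    apply ENNReal.ofReal_le_ofReal
    refine h2.trans (le_of_eq ?_)
    congr 1
    norm_num
    ring
  have key : ∀ t, ∫⁻ ω, ENNReal.ofReal (Real.exp (l * D t (fun v j => Y v j ω))) ∂μ ≤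
      ENNReal.ofReal (Real.exp (l ^ 2 / 8)) ^ t := by
    intro t
    induction t with
    | zero => simp [D]
    | succ t ih =>
      have h := lintegral_pulled_le A hY hind t
        (F := fun z => ENNReal.ofReal (Real.exp (l * D t z)))
        (((hDm t).const_mul l).exp.ennreal_ofReal) (fun z z' h => by rw [hDt t z z' h])
        (G := fun v _ u => ENNReal.ofReal (Real.exp (l * (g v - u 0))))
        (fun v k => by fun_prop) (c := ENNReal.ofReal (Real.exp (l ^ 2 / 8)))
        (fun v k => by simpa using hmgf v (k + 0))
      calc _ = _ := by
            refine lintegral_congr fun ω => ?_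
            rw [← ENNReal.ofReal_mul (Real.exp_pos _).le, ← Real.exp_add]
            simp only [D, Finset.sum_range_succ, add_zero, mul_add]
        _ ≤ _ := h
        _ ≤ _ := by
            rw [pow_succ' _ t]
            exact mul_le_mul' le_rfl ih
  have hm : Measurable fun ω => ENNReal.ofReal (Real.exp (l * D n (fun v j => Y v j ω))) :=
    ((((hDm n).const_mul l).exp.ennreal_ofReal)).comp
      (measurable_pi_iff.2 fun v => measurable_pi_iff.2 fun j => hY v j)
  have hmarkov := mul_meas_ge_le_lintegral (μ := μ) hm (ENNReal.ofReal (Real.exp (l * a)))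
  have hpos : 0 < Real.exp (l * a) := Real.exp_pos _
  have h1 : ENNReal.ofReal (Real.exp (l * a)) *
      μ {ω | a ≤ D n (fun v j => Y v j ω)} ≤
      ENNReal.ofReal (Real.exp (l * a)) * ENNReal.ofReal (Real.exp (-(2 * a ^ 2 / n))) := by
    calc _ ≤ _ := by
          gcongr
          rename_i ω
          intro hω
          apply ENNReal.ofReal_le_ofReal
          apply Real.exp_le_exp.2
          exact mul_le_mul_of_nonneg_left hω hl0
      _ ≤ _ := hmarkov
      _ ≤ _ := key n
      _ = _ := by
          rw [← ENNReal.ofReal_mul hpos.le, ← ENNReal.ofReal_pow (Real.exp_pos _).le,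
            ← Real.exp_add, ← Real.exp_nat_mul]
          congr 2
          rw [hl]
          field_simp
          ring
  exact (ENNReal.mul_le_mul_iff_right (by simpa using hpos) ENNReal.ofReal_ne_top).1 h1

end Adapted

/-! ### The choice of the depth -/

/-- With `r = l / n` and `H` near `r ^ (-p)`, the left side of the last inequality is at most `K n r
^ p`, while the target is `e n r ^ q` with `q < p`. The surplus `r ^ (p - q)` beats any constant
once `r` is small. -/
lemma exists_depth {d e K₁ K₂ H₀ : ℝ} (hd : 0 < d) (he : 0 < e) (hK₁ : 0 < K₁) (hK₂ : 0 < K₂) :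
    ∃ C₂ : ℝ, 0 < C₂ ∧ ∀ (n : ℕ) (l : ℝ), 1 ≤ n → 0 < l →
      (n : ℝ) + 1 ≤ C₂ * (n : ℝ) ^ ((2 * d + 1) / (2 * d + 3)) * l ∨
      ∃ H : ℕ, 1 ≤ H ∧ H₀ ≤ H ∧ K₁ * (l * (H : ℝ) ^ (d + 2)) + K₂ * (n / H) ≤
        e * (n : ℝ) ^ ((2 * d + 2) / (2 * d + 3)) * l ^ (1 / (2 * d + 3)) := by
  set p : ℝ := 1 / (d + 3) with hp
  set q : ℝ := 1 / (2 * d + 3) with hq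
  have hp0 : 0 < p := by positivity
  have hq0 : 0 < q := by positivity
  have hpq : 0 < p - q := by
    rw [hp, hq, sub_pos]
    apply one_div_lt_one_div_of_lt <;> linarith
  set K := K₁ * 2 ^ (d + 2) + K₂ with hK
  have hK0 : 0 < K := by positivity
  have htend : ∀ r : ℝ, 0 < r → Filter.Tendsto (fun c : ℝ => c ^ r) (nhdsWithin 0 (Set.Ioi 0))
      (nhds 0) := by
    intro r hr
    have h := (Real.continuousAt_rpow_const 0 r (Or.inr hr.le)).tendsto
    rw [Real.zero_rpow hr.ne'] at h
    exact h.mono_left nhdsWithin_le_nhds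
  have hH1 : 0 < max H₀ 1 := by positivity
  -- For `r ≤ c` the first condition gives `H ≥ H₀`, and the second makes the surplus power absorb
  -- `K / e`.
  obtain ⟨c, hc1, hc2, hc3, hc0⟩ : ∃ c : ℝ, c ^ p ≤ 1 / max H₀ 1 ∧ c ^ (p - q) ≤ e / K ∧ c ≤ 1 ∧
      0 < c := by
    have h1 := (htend p hp0).eventually (ge_mem_nhds (show 0 < 1 / max H₀ 1 by positivity))
    have h2 := (htend (p - q) hpq).eventually (ge_mem_nhds (show 0 < e / K by positivity))
    have h3 : ∀ᶠ c : ℝ in nhdsWithin 0 (Set.Ioi 0), c ≤ 1 :=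
      nhdsWithin_le_nhds (ge_mem_nhds one_pos)
    exact (h1.and (h2.and (h3.and self_mem_nhdsWithin))).exists
  refine ⟨2 / c, by positivity, fun n l hn hl => ?_⟩
  have hn1 : (1 : ℝ) ≤ n := by exact_mod_cast hn
  have hn0 : (0 : ℝ) < n := by linarith
  by_cases hcase : c * (n : ℝ) ^ (2 / (2 * d + 3)) ≤ l
  · left
    calc (n : ℝ) + 1 ≤ 2 * (n : ℝ) ^ (1 : ℝ) := by rw [Real.rpow_one]; linarith
      _ = 2 * ((n : ℝ) ^ ((2 * d + 1) / (2 * d + 3)) * (n : ℝ) ^ (2 / (2 * d + 3))) := by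
          rw [← Real.rpow_add hn0]
          congr 2
          field_simp
          ring
      _ = 2 / c * (n : ℝ) ^ ((2 * d + 1) / (2 * d + 3)) *
          (c * (n : ℝ) ^ (2 / (2 * d + 3))) := by field_simp
      _ ≤ _ := by gcongr
  · right
    push Not at hcase
    set r := l / n with hr
    have hr0 : 0 < r := by positivity
    have hrc : r ≤ c := by
      rw [hr, div_le_iff₀ hn0]
      refine hcase.le.trans ?_
      gcongr
      calc (n : ℝ) ^ (2 / (2 * d + 3)) ≤ (n : ℝ) ^ (1 : ℝ) := by
            apply Real.rpow_le_rpow_of_exponent_le hn1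
            rw [div_le_one (by positivity)]
            linarith
        _ = n := Real.rpow_one _
    have hl : l = n * r := by rw [hr]; field_simp
    have hrp : 0 < r ^ p := by positivity
    have hrp1 : r ^ p ≤ 1 / max H₀ 1 := (Real.rpow_le_rpow hr0.le hrc hp0.le).trans hc1
    have hinv : max H₀ 1 ≤ 1 / r ^ p := by
      rw [le_div_iff₀ hrp]
      rw [le_div_iff₀ hH1] at hrp1
      linarith
    set H := ⌈1 / r ^ p⌉₊ with hH
    have hH2 : 1 / r ^ p ≤ H := Nat.le_ceil _
    have hH3 : (H : ℝ) ≤ 2 * (1 / r ^ p) := by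
      have h1 := (Nat.ceil_lt_add_one (show 0 ≤ 1 / r ^ p by positivity)).le
      have h2 := (le_max_right H₀ 1).trans hinv
      linarith
    have hHpos : (0 : ℝ) < H := lt_of_lt_of_le (by positivity) hH2
    refine ⟨H, Nat.one_le_iff_ne_zero.2 (by exact_mod_cast hHpos.ne'),
      ((le_max_left _ _).trans hinv).trans hH2, ?_⟩
    have h1 : l * (H : ℝ) ^ (d + 2) ≤ 2 ^ (d + 2) * (n * r ^ p) := by
      calc l * (H : ℝ) ^ (d + 2) ≤ l * (2 * (1 / r ^ p)) ^ (d + 2) := by gcongr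
        _ = 2 ^ (d + 2) * (n * (r ^ (1 : ℝ) * (r ^ (-p)) ^ (d + 2))) := by
            rw [Real.mul_rpow (by norm_num) (by positivity), one_div, ← Real.rpow_neg hr0.le,
              Real.rpow_one, hl]
            ring
        _ = 2 ^ (d + 2) * (n * r ^ p) := by
            rw [← Real.rpow_mul hr0.le, ← Real.rpow_add hr0]
            congr 3
            rw [hp]
            field_simp
            ring
    have h2 : n / (H : ℝ) ≤ n * r ^ p := by
      rw [div_le_iff₀ hHpos]
      have h3 : 1 ≤ r ^ p * H := by
        rw [div_le_iff₀ hrp] at hH2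
        linarith
      nlinarith
    calc K₁ * (l * (H : ℝ) ^ (d + 2)) + K₂ * (n / H)
        ≤ K₁ * (2 ^ (d + 2) * (n * r ^ p)) + K₂ * (n * r ^ p) := by gcongr
      _ = n * r ^ q * (K * r ^ (p - q)) := by
          have : r ^ p = r ^ q * r ^ (p - q) := by rw [← Real.rpow_add hr0]; congr 1; ring
          rw [this, hK]
          ring
      _ ≤ n * r ^ q * e := by
          gcongr
          have h3 := (Real.rpow_le_rpow hr0.le hrc hpq.le).trans hc2
          rw [le_div_iff₀ hK0] at h3
          linarith
      _ = e * (n : ℝ) ^ ((2 * d + 2) / (2 * d + 3)) * l ^ q := by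
          have h4 : (2 * d + 2) / (2 * d + 3) = 1 + -q := by rw [hq]; field_simp; ring
          rw [h4, Real.rpow_add hn0, Real.rpow_one, Real.rpow_neg hn0.le, hr,
            Real.div_rpow (by rw [hl]; positivity) hn0.le]
          ring

/-! ### The regret bound on a favourable sample path -/

lemma logTerm_eq {δ : ℝ} (t : ℕ) : logTerm δ t = Real.log (3 * tPlus t / δ) := by
  rw [logTerm, one_div_div]

lemma log_two_le_log_div {n : ℕ} {δ : ℝ} (hn : 2 ≤ n) (hδ : 0 < δ) (hδ1 : δ ≤ 1) :
    Real.log 2 ≤ Real.log (n / δ) := by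
  have hn' : (2 : ℝ) ≤ n := by exact_mod_cast hn
  apply Real.log_le_log (by norm_num)
  rw [le_div_iff₀ hδ]
  nlinarith

/-- A single level `L = log (3 √n / δ)` serves all rounds from `√n` on, where `tPlus` is at least
`√n`. It differs from `log (n / δ)` only by bounded factors, and the earlier rounds cost at most `1`
each. -/
lemma sum_gap_le_of_favourable {A : Params} {y : Node → ℕ → ℝ} {g : Node → ℝ} {O : Node → Prop}
    {fs C d ε κ : ℝ} {n H : ℕ} (hb : 0 < A.b) (hδ : 0 < A.δ) (hδ1 : A.δ ≤ 1)
    (hφ : A.φ = fun h : ℕ => 1 / (h : ℝ))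
    (hO0 : O []) (hO : ∀ v, O v → O (false :: v) ∨ O (true :: v))
    (hOg : ∀ v, v ≠ [] → O v → fs - 1 / (v.length : ℝ) ≤ g v)
    (hg : ∀ v, fs - g v ≤ 1) (hV : ∀ v T, empVar (y v) T ≤ A.b ^ 2) (hC : 0 < C) (hd : 0 < d)
    (hcount : ∀ h : ℕ, 1 ≤ h →
      (Set.ncard {v : Node | v.length = h ∧ fs - 3 * (1 / (h : ℝ)) ≤ g v} : ℝ) ≤ C * (h : ℝ) ^ d)
    (hn : 2 ≤ n) (hfav : Favourable A y g n (Real.log (3 * √(n : ℝ) / A.δ)) κ ε) (hε : 0 < ε)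
    (hκ : κ ≤ 27 * A.b * H) (hH : 1 ≤ H) :
    ∑ t ∈ Finset.range n, (fs - g (pulled A y t)) ≤ √(n : ℝ) +
      3 * (1 + 94 * A.b) * (8 * (1 + C) * (Real.log (n / A.δ) * (H : ℝ) ^ (d + 2)) +
        (2 / ε + 1) * (n / H)) := by
  have hn' : (2 : ℝ) ≤ n := by exact_mod_cast hn
  have hsn : 0 < √(n : ℝ) := Real.sqrt_pos.2 (by linarith)
  have hsn1 : 1 ≤ √(n : ℝ) := Real.one_le_sqrt.2 (by linarith)
  have hsn2 : √(n : ℝ) ^ 2 = n := Real.sq_sqrt (by linarith)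
  have hlog := log_two_le_log_div hn hδ hδ1
  have hlog2 := Real.log_two_gt_d9
  have hn0 : (0 : ℝ) < n := by linarith
  have hL1 : 1 < 3 * √(n : ℝ) / A.δ := by
    rw [lt_div_iff₀ hδ]
    linarith
  rw [← Finset.sum_filter_add_sum_filter_not (Finset.range n)
    (fun t : ℕ => (t : ℝ) + 1 < √(n : ℝ))]
  refine add_le_add ?_ ?_
  · calc ∑ t ∈ (Finset.range n).filter fun t : ℕ => (t : ℝ) + 1 < √(n : ℝ),
          (fs - g (pulled A y t))
        ≤ ((Finset.range n).filter fun t : ℕ => (t : ℝ) + 1 < √(n : ℝ)).card • (1 : ℝ) :=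
          Finset.sum_le_card_nsmul _ _ _ fun t _ => hg _
      _ ≤ (⌊√(n : ℝ)⌋₊ : ℝ) := by
          rw [nsmul_eq_mul, mul_one]
          have hsub : ((Finset.range n).filter fun t : ℕ => (t : ℝ) + 1 < √(n : ℝ)) ⊆
              Finset.range ⌊√(n : ℝ)⌋₊ := by
            intro t ht
            refine Finset.mem_range.2 (Nat.succ_le_iff.1 (Nat.le_floor ?_))
            push_cast
            exact (Finset.mem_filter.1 ht).2.le
          have := Finset.card_le_card hsub
          rw [Finset.card_range] at this
          exact_mod_cast this
      _ ≤ √(n : ℝ) := Nat.floor_le hsn.le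
  · refine sum_gap_le hb hδ hφ hO0 hO hOg hg hV hC hd hcount hfav hε hκ hH (Real.log_pos hL1)
      (by linarith) ?_ (Finset.filter_subset _ _) ?_ ?_
    · have h2 : 2 * Real.log (3 * √(n : ℝ) / A.δ) = Real.log ((3 * √(n : ℝ) / A.δ) ^ 2) := by
        rw [Real.log_pow]; norm_num
      rw [h2]
      apply Real.log_le_log (by positivity)
      rw [div_pow, mul_pow, hsn2, div_le_div_iff₀ hδ (by positivity)]
      have h3 : (n : ℝ) * A.δ ^ 2 ≤ n * A.δ := by
        have : A.δ ^ 2 ≤ A.δ := by nlinarith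
        gcongr
      nlinarith [mul_pos hn0 hδ]
    · intro t ht
      have h3 := not_lt.1 (Finset.mem_filter.1 ht).2
      rw [logTerm_eq]
      apply Real.log_le_log (by positivity)
      have h4 : ((t + 1 : ℕ) : ℝ) ≤ tPlus (t + 1) := by exact_mod_cast (lt_tPlus (t + 1)).le
      push_cast at h4
      gcongr
      linarith
    · intro t ht
      have h3 := Finset.mem_range.1 (Finset.mem_filter.1 ht).1
      have h4 : (tPlus (t + 1) : ℝ) ≤ 2 * n := by
        have : tPlus (t + 1) ≤ 2 * n := (tPlus_le (by omega)).trans (by omega)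
        exact_mod_cast this
      have h5 : (0 : ℝ) < tPlus (t + 1) := by exact_mod_cast tPlus_pos _
      rw [logTerm_eq]
      calc Real.log (3 * tPlus (t + 1) / A.δ) ≤ Real.log (2 ^ 3 * (n / A.δ)) := by
            apply Real.log_le_log (by positivity)
            rw [mul_div_assoc']
            exact div_le_div_of_nonneg_right (by linarith) hδ.le
        _ = 3 * Real.log 2 + Real.log (n / A.δ) := by
            rw [Real.log_mul (by norm_num) (by positivity), Real.log_pow]
            norm_num
        _ ≤ _ := by linarith

/-- One of the two square-root terms of the regret bound pays for the early rounds and for the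
margin `1 / 2`. -/
lemma sqrt_add_half_le {n : ℕ} {δ : ℝ} (hn : 1 ≤ n) (hδ : 0 < δ) (hδ1 : δ ≤ 1) :
    √(n : ℝ) + 1 / 2 ≤ √(2 * n * Real.log (4 * (n : ℝ) ^ 2 / δ)) := by
  have hn1 : (1 : ℝ) ≤ n := by exact_mod_cast hn
  have h1 : Real.log 4 ≤ Real.log (4 * (n : ℝ) ^ 2 / δ) := by
    apply Real.log_le_log (by norm_num)
    rw [le_div_iff₀ hδ]
    nlinarith
  have h2 : Real.log 4 = 2 * Real.log 2 := by
    rw [show (4 : ℝ) = 2 ^ 2 by norm_num, Real.log_pow]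
    norm_num
  have h3 := Real.log_two_gt_d9
  have h4 : √(n : ℝ) + 1 / 2 ≤ 3 / 2 * √(n : ℝ) := by
    have := Real.one_le_sqrt.2 hn1
    linarith
  refine h4.trans (Real.le_sqrt_of_sq_le ?_)
  rw [mul_pow, Real.sq_sqrt (by linarith)]
  nlinarith

/-! ### Consequences of the assumptions on the setting -/

section Setting

variable {X : Type*} {P : HPartition X} {f : X → ℝ} {ν : X → Measure ℝ} {b : ℝ}

lemma IsRewardModel.mem_Icc (hν : IsRewardModel f b ν) (x : X) : f x ∈ Set.Icc (0 : ℝ) 1 := by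
  have := hν.prob x
  have hi : Integrable (fun r : ℝ => r) (ν x) :=
    Integrable.of_mem_Icc 0 1 aemeasurable_id (hν.reward_mem x)
  rw [← hν.mean_eq x]
  constructor
  · refine integral_nonneg_of_ae ?_
    filter_upwards [hν.reward_mem x] with r hr using hr.1
  · have h : ∫ r, r ∂ν x ≤ ∫ _, (1 : ℝ) ∂ν x := by
      refine integral_mono_ae hi (integrable_const 1) ?_
      filter_upwards [hν.reward_mem x] with r hr using hr.2
    simpa using h

lemma nearOptCount_le {C d : ℝ} (hC : 0 < C)
    (h : nearOptDim P f 3 C (fun h => 1 / (h : ℝ)) < ENNReal.ofReal d) (k : ℕ) (hk : 1 ≤ k) :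
    (Set.ncard {v : Node | v.length = k ∧ (⨆ z, f z) - 3 * (1 / (k : ℝ)) ≤ f (P.arm v)} : ℝ) ≤
      C * (k : ℝ) ^ d := by
  unfold nearOptDim at h
  simp only [iInf_lt_iff] at h
  obtain ⟨e, he, hed⟩ := h
  have hk' : (1 : ℝ) ≤ k := by exact_mod_cast hk
  have hed' : (e : ℝ) ≤ d := by
    rw [ENNReal.lt_ofReal_iff_toReal_lt ENNReal.coe_ne_top] at hed
    exact hed.le
  calc _ ≤ C * (1 / (k : ℝ)) ^ (-(e : ℝ)) := he k hk
    _ = C * (k : ℝ) ^ (e : ℝ) := by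
        rw [one_div, Real.inv_rpow (by linarith), Real.rpow_neg (by linarith), inv_inv]
    _ ≤ _ := by gcongr

lemma iSup_eq_of_isMax {xs : X} (hxs : ∀ z, f z ≤ f xs) : ⨆ z, f z = f xs := by
  have : Nonempty X := ⟨xs⟩
  exact le_antisymm (ciSup_le hxs) (le_ciSup ⟨f xs, by rintro _ ⟨z, rfl⟩; exact hxs z⟩ xs)

end Setting

lemma regretBound_ge {C₁ C₂ d V δ : ℝ} {n : ℕ} (hC₁ : 0 ≤ C₁) (hC₂ : 0 ≤ C₂) (hV : 0 ≤ V)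
    (hn : 1 ≤ n) (hδ : 0 < δ) (hδ1 : δ ≤ 1) :
    2 * √(2 * n * Real.log (4 * (n : ℝ) ^ 2 / δ)) ≤ regretBound C₁ C₂ d V n δ ∧
    2 * √(2 * n * Real.log (4 * (n : ℝ) ^ 2 / δ)) +
      C₁ * V ^ (1 / (4 * d + 6)) * (n : ℝ) ^ ((2 * d + 2) / (2 * d + 3)) *
        Real.log (n / δ) ^ (1 / (2 * d + 3)) ≤ regretBound C₁ C₂ d V n δ ∧
    C₂ * (n : ℝ) ^ ((2 * d + 1) / (2 * d + 3)) * Real.log (n / δ) ≤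
      regretBound C₁ C₂ d V n δ - 2 * √(2 * n * Real.log (4 * (n : ℝ) ^ 2 / δ)) := by
  have hn1 : (1 : ℝ) ≤ n := by exact_mod_cast hn
  have hl : 0 ≤ Real.log (n / δ) := by
    apply Real.log_nonneg
    rw [le_div_iff₀ hδ]
    linarith
  have h1 : 0 ≤ C₁ * V ^ (1 / (4 * d + 6)) * (n : ℝ) ^ ((2 * d + 2) / (2 * d + 3)) *
        Real.log (n / δ) ^ (1 / (2 * d + 3)) := by positivity
  have h2 : 0 ≤ C₂ * (n : ℝ) ^ ((2 * d + 1) / (2 * d + 3)) * Real.log (n / δ) := by positivity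
  unfold regretBound
  refine ⟨by linarith, by linarith, by linarith⟩

lemma regret_le_card {X : Type*} {f : X → ℝ} (A : Params) {y : Node → ℕ → ℝ}
    (hf : ⨆ z, f z ≤ 1) (hy : ∀ v j, 0 ≤ y v j) (n : ℕ) : regret f A y n ≤ n := by
  rw [regret_eq]
  refine (Finset.sum_le_card_nsmul _ _ 1 fun t _ => ?_).trans (by simp)
  have := hy (pulled A y t) (pullIdx A y t)
  linarith

lemma abs_regret_le {X : Type*} {f : X → ℝ} (A : Params) {y : Node → ℕ → ℝ}
    (hf0 : 0 ≤ ⨆ z, f z) (hf : ⨆ z, f z ≤ 1) (hy : ∀ v j, y v j ∈ Set.Icc (0 : ℝ) 1) (n : ℕ) :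
    |regret f A y n| ≤ n := by
  rw [regret_eq]
  refine (Finset.abs_sum_le_sum_abs _ _).trans ?_
  refine (Finset.sum_le_card_nsmul _ _ 1 fun t _ => ?_).trans (by simp)
  obtain ⟨h1, h2⟩ := hy (pulled A y t) (pullIdx A y t)
  exact abs_le.2 ⟨by linarith, by linarith⟩

section Main

variable {X : Type*} {P : HPartition X} {f : X → ℝ} {ν : X → Measure ℝ} {b C d ε : ℝ}
  {Ω : Type*} [MeasurableSpace Ω] {μ : Measure Ω} {Y : Node → ℕ → Ω → ℝ}

lemma IsRewardSample.ae_all (hν : IsRewardModel f b ν) (hY : IsRewardSample P ν Y μ) :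
    ∀ᵐ ω ∂μ, ∀ v j, Y v j ω ∈ Set.Icc (0 : ℝ) 1 ∧ |Y v j ω - f (P.arm v)| ≤ b / 2 := by
  refine ae_all_iff.2 fun v => ae_all_iff.2 fun j => ?_
  have h : ∀ᵐ r ∂μ.map (Y v j), r ∈ Set.Icc (0 : ℝ) 1 ∧ |r - f (P.arm v)| ≤ b / 2 := by
    rw [(hY.law v j).map_eq]
    exact (hν.reward_mem _).and (hν.noise_le _)
  exact ae_of_ae_map (hY.measurable v j).aemeasurable h

lemma IsRewardSample.integral_eq (hν : IsRewardModel f b ν) (hY : IsRewardSample P ν Y μ)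
    (v : Node) (j : ℕ) : ∫ ω, Y v j ω ∂μ = f (P.arm v) :=
  (hY.law v j).integral_eq.trans (hν.mean_eq _)

lemma IsRewardSample.integral_sq_eq (hν : IsRewardModel f b ν) (hY : IsRewardSample P ν Y μ)
    (v : Node) (j : ℕ) :
    ∫ ω, (Y v j ω - f (P.arm v)) ^ 2 ∂μ = variance id (ν (P.arm v)) := by
  rw [← (hY.law v j).variance_eq, variance_eq_integral (hY.measurable v j).aemeasurable,
    hY.integral_eq hν]

lemma measurableSet_confAt (m L κ : ℝ) (T : ℕ) :
    MeasurableSet {u : ℕ → ℝ | ConfAt u m b L κ ε T} := by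
  have h1 := measurable_empMean (z := fun (u : ℕ → ℝ) (_ : Node) => u)
    (fun _ j => measurable_pi_apply j) [] T
  have h2 := measurable_empVar (z := fun (u : ℕ → ℝ) (_ : Node) => u)
    (fun _ j => measurable_pi_apply j) [] T
  have h3 : Measurable fun u : ℕ → ℝ => statErr b L (empVar u T) T := by
    unfold statErr
    fun_prop
  have h4 : Measurable fun u : ℕ → ℝ => |empMean u T - m| := by
    have := h1.sub_const m
    fun_prop
  refine (measurableSet_le h4 h3).inter ?_
  by_cases h : κ * L ≤ T
  · simp only [h, forall_const]
    exact measurableSet_le measurable_const h2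
  · simp only [h, false_imp_iff]
    exact MeasurableSet.univ

/-- With high probability the sample path is favourable. -/
lemma measure_not_favourable_le [IsProbabilityMeasure μ] (A : Params) (hb : 0 < b) (hA : A.b = b) (hε : 0 < ε)
    (hν : IsRewardModel f b ν) (hY : IsRewardSample P ν Y μ)
    (hvar : ∀ v, ε ≤ variance id (ν (P.arm v))) (n : ℕ) {L : ℝ} (hL : 0 < L) :
    μ {ω | ¬ Favourable A (fun v j => Y v j ω) (fun v => f (P.arm v)) n L
      (57 * b ^ 4 / ε ^ 2) ε} ≤ ENNReal.ofReal (n * (n * (3 * Real.exp (-(9 * L))))) := by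
  set κ := 57 * b ^ 4 / ε ^ 2
  let B : Node → Set (ℕ → ℝ) := fun v =>
    ⋃ T ∈ Finset.Icc 1 n, {u | ConfAt u (f (P.arm v)) b L κ ε T}ᶜ
  have hB : ∀ v, MeasurableSet (B v) := fun v =>
    Finset.measurableSet_biUnion _ fun T _ => (measurableSet_confAt _ L κ T).compl
  have hae := hY.ae_all hν
  have hp : ∀ v, μ {ω | (fun j => Y v j ω) ∈ B v} ≤
      ENNReal.ofReal (n * (3 * Real.exp (-(9 * L)))) := by
    intro v
    have h1 : ∀ T ∈ Finset.Icc 1 n, μ {ω | ¬ ConfAt (fun j => Y v j ω) (f (P.arm v)) b L κ ε T} ≤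
        ENNReal.ofReal (3 * Real.exp (-(9 * L))) := by
      intro T hT
      have hσ : √(variance id (ν (P.arm v))) ^ 2 = variance id (ν (P.arm v)) :=
        Real.sq_sqrt (hε.le.trans (hvar v))
      have hind : iIndepFun (fun j => Y v j) μ :=
        hY.indep.precomp (g := fun j : ℕ => (v, j)) fun i j h => (Prod.mk.inj h).2
      have := measureReal_not_confAt_le (μ := μ) (X := fun j => Y v j) (hY.measurable v) hind
        (fun j => hae.mono fun ω h => (h v j).2) (hY.integral_eq hν v)
        (fun j => (hY.integral_sq_eq hν v j).trans hσ.symm) hb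
        (Real.sqrt_pos.2 (hε.trans_le (hvar v))) hL hε (hσ.symm ▸ hvar v) (Finset.mem_Icc.1 hT).1
      rw [← ofReal_measureReal]
      exact ENNReal.ofReal_le_ofReal this
    calc μ {ω | (fun j => Y v j ω) ∈ B v}
        ≤ μ (⋃ T ∈ Finset.Icc 1 n, {ω | ¬ ConfAt (fun j => Y v j ω) (f (P.arm v)) b L κ ε T}) := by
          refine measure_mono fun ω hω => ?_
          obtain ⟨T, hT, h⟩ := Set.mem_iUnion₂.1 hω
          exact Set.mem_iUnion₂.2 ⟨T, hT, h⟩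
      _ ≤ ∑ T ∈ Finset.Icc 1 n, _ := measure_biUnion_finset_le _ _
      _ ≤ ∑ T ∈ Finset.Icc 1 n, ENNReal.ofReal (3 * Real.exp (-(9 * L))) :=
          Finset.sum_le_sum h1
      _ = _ := by
          rw [ENNReal.ofReal_mul (by positivity)]
          simp
  refine le_trans (measure_mono fun ω hω => ?_)
    ((measure_exists_pulled_le A hY.measurable hY.indep hB hp n).trans (le_of_eq ?_))
  · by_contra hcon
    refine hω fun v hv T hT1 hTn => ?_
    by_contra hc
    rw [hA] at hc
    exact hcon ⟨v, hv, Set.mem_iUnion₂.2 ⟨T, Finset.mem_Icc.2 ⟨hT1, hTn⟩, hc⟩⟩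
  · rw [ENNReal.ofReal_mul (by positivity)]
    simp

/-- The regret bound with a margin, in terms of the measure of the exceptional set. -/
lemma measure_regret_gt_le (hC : 0 < C) (hb : 0 < b) (hd : 0 < d) (hε : 0 < ε) :
    ∃ C₂ : ℝ, 0 < C₂ ∧ ∀ (X : Type*) (P : HPartition X) (f : X → ℝ) (ν : X → Measure ℝ)
      (Ω : Type*) (_ : MeasurableSpace Ω) (μ : Measure Ω) (_ : IsProbabilityMeasure μ)
      (Y : Node → ℕ → Ω → ℝ) (V : ℝ) (tie : ℕ → Node → Bool),
      LocallySmooth P f (fun h => 1 / (h : ℝ)) →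
      nearOptDim P f 3 C (fun h => 1 / (h : ℝ)) < ENNReal.ofReal d →
      IsRewardModel f b ν → IsRewardSample P ν Y μ →
      (∀ v, ε ≤ variance id (ν (P.arm v)) ∧ variance id (ν (P.arm v)) ≤ V) →
      ∀ (n : ℕ) (δ : ℝ), 1 ≤ n → 0 < δ → δ ≤ 1 →
        μ {ω | regretBound 1 C₂ d V n δ - 1 / 2 <
          regret f ⟨fun h => 1 / (h : ℝ), b, δ, tie⟩ (fun v s => Y v s ω) n} ≤
          ENNReal.ofReal (δ / (4 * (n : ℝ) ^ 2)) := by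
  set κ := 57 * b ^ 4 / ε ^ 2 with hκ
  -- Since `ε ≤ V`, this `e` is at most the factor `V ^ (1 / (4 * d + 6))` of the target; `H₀` makes
  -- the variance condition `κ ≤ 27 b H` true.
  obtain ⟨C₂, hC₂, hdepth⟩ := exists_depth (e := ε ^ (1 / (4 * d + 6)))
    (K₁ := 3 * (1 + 94 * b) * (8 * (1 + C))) (K₂ := 3 * (1 + 94 * b) * (2 / ε + 1))
    (H₀ := κ / (27 * b)) hd (by positivity) (by positivity) (by positivity)
  refine ⟨C₂, hC₂, ?_⟩
  intro X P f ν Ω _ μ _ Y V tie hsmooth hdim hν hY hvar n δ hn hδ hδ1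
  obtain ⟨xs, hxs, hsm⟩ := hsmooth
  have hsup := iSup_eq_of_isMax hxs
  have hfs := hν.mem_Icc xs
  have hfs1 : ⨆ z, f z ≤ 1 := hsup ▸ hfs.2
  have hae := hY.ae_all hν
  have hεV : ε ≤ V := (hvar []).1.trans (hvar []).2
  obtain ⟨hbd1, hbd2, hbd3⟩ := regretBound_ge (C₁ := 1) (C₂ := C₂) (d := d) (V := V) zero_le_one
    hC₂.le (hε.le.trans hεV) hn hδ hδ1
  have hsq := sqrt_add_half_le hn hδ hδ1
  have hn1 : (1 : ℝ) ≤ n := by exact_mod_cast hn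
  have hn0 : (0 : ℝ) < n := by linarith
  set a := √(2 * n * Real.log (4 * (n : ℝ) ^ 2 / δ)) with ha
  have htriv : (n : ℝ) ≤ regretBound 1 C₂ d V n δ - 1 / 2 →
      μ {ω | regretBound 1 C₂ d V n δ - 1 / 2 <
          regret f ⟨fun h => 1 / (h : ℝ), b, δ, tie⟩ (fun v s => Y v s ω) n} ≤
          ENNReal.ofReal (δ / (4 * (n : ℝ) ^ 2)) := by
    intro h
    refine le_trans (le_of_eq ?_) zero_le
    refine measure_mono_null (t := {ω | ¬ ∀ v j, Y v j ω ∈ Set.Icc (0 : ℝ) 1 ∧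
      |Y v j ω - f (P.arm v)| ≤ b / 2}) (fun ω hω hω' => ?_) hae
    have := regret_le_card ⟨fun h => 1 / (h : ℝ), b, δ, tie⟩ hfs1 (fun v j => (hω' v j).1.1) n
    exact absurd (lt_of_lt_of_le hω (this.trans h)) (lt_irrefl _)
  -- For `n = 1` the logarithm of `n / δ` may vanish, and the choice of the depth needs it to be
  -- positive.
  rcases hn.eq_or_lt with rfl | hn2
  · apply htriv
    have : (1 : ℝ) ≤ √((1 : ℕ) : ℝ) := by simp
    push_cast at *
    linarith
  have hlog : 0 < Real.log (n / δ) :=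
    (Real.log_pos one_lt_two).trans_le (log_two_le_log_div hn2 hδ hδ1)
  rcases hdepth n _ hn hlog with h | ⟨H, hH1, hH0, hH⟩
  · apply htriv
    linarith [Real.sqrt_nonneg (n : ℝ)]
  set A : Params := ⟨fun h => 1 / (h : ℝ), b, δ, tie⟩ with hA
  set L := Real.log (3 * √(n : ℝ) / δ) with hL
  have hsn1 : 1 ≤ √(n : ℝ) := Real.one_le_sqrt.2 hn1
  have hL1 : 1 < 3 * √(n : ℝ) / δ := by
    rw [lt_div_iff₀ hδ]
    linarith
  have hL0 : 0 < L := Real.log_pos hL1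
  set F : Set Ω := {ω | ¬ Favourable A (fun v j => Y v j ω) (fun v => f (P.arm v)) n L κ ε}
  set D : Set Ω := {ω | a ≤ ∑ t ∈ Finset.range n, (f (P.arm (pulled A (fun v j => Y v j ω) t)) -
      Y (pulled A (fun v j => Y v j ω) t) (pullIdx A (fun v j => Y v j ω) t) ω)}
  -- The exponent `9`, which is the square of `c = 3`, turns `3 √n / δ` into a probability of order
  -- `δ / n ^ 4`; this survives the union over `n` rounds and `n` sample sizes.
  have hF : μ F ≤ ENNReal.ofReal (δ / (8 * (n : ℝ) ^ 2)) := by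
    refine (measure_not_favourable_le A hb rfl hε hν hY (fun v => (hvar v).1) n hL0).trans ?_
    apply ENNReal.ofReal_le_ofReal
    have h1 : Real.exp (-(9 * L)) = (δ / (3 * √(n : ℝ))) ^ 9 := by
      rw [Real.exp_neg, show 9 * L = (9 : ℕ) * L by norm_num, Real.exp_nat_mul,
        hL, Real.exp_log (by positivity), ← inv_pow, inv_div]
    have h2 : (δ / (3 * √(n : ℝ))) ^ 9 ≤ δ / (3 ^ 9 * (n : ℝ) ^ 4) := by
      rw [div_pow, mul_pow]
      have h3 : (n : ℝ) ^ 4 ≤ √(n : ℝ) ^ 9 := by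
        calc (n : ℝ) ^ 4 = (√(n : ℝ) ^ 2) ^ 4 := by rw [Real.sq_sqrt hn0.le]
          _ = √(n : ℝ) ^ 8 := by ring
          _ ≤ _ := pow_le_pow_right₀ hsn1 (by norm_num)
      have h4 : δ ^ 9 ≤ δ := pow_le_of_le_one hδ.le hδ1 (by norm_num)
      gcongr
    calc n * (n * (3 * Real.exp (-(9 * L)))) ≤ n * (n * (3 * (δ / (3 ^ 9 * (n : ℝ) ^ 4)))) := by
          rw [h1]; gcongr
      _ = δ / (6561 * (n : ℝ) ^ 2) := by field_simp; norm_num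
      _ ≤ _ := by gcongr; norm_num
  have hD : μ D ≤ ENNReal.ofReal (δ / (8 * (n : ℝ) ^ 2)) := by
    refine (measure_sum_sub_received_ge_le A hY.measurable hY.indep (g := fun v => f (P.arm v))
      (fun v j => hae.mono fun ω h => (h v j).1) (hY.integral_eq hν) hn
      (Real.sqrt_nonneg _)).trans ?_
    apply ENNReal.ofReal_le_ofReal
    have hlog4 : 0 ≤ Real.log (4 * (n : ℝ) ^ 2 / δ) := by
      apply Real.log_nonneg
      rw [le_div_iff₀ hδ]
      nlinarith
    have h1 : -(2 * a ^ 2 / n) = -((4 : ℕ) * Real.log (4 * (n : ℝ) ^ 2 / δ)) := by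
      rw [ha, Real.sq_sqrt (by positivity)]
      push_cast
      field_simp
      norm_num
    rw [h1, Real.exp_neg, Real.exp_nat_mul, Real.exp_log (by positivity), ← inv_pow, inv_div]
    have h2 : δ / (4 * (n : ℝ) ^ 2) ≤ 1 / 4 := by
      rw [div_le_div_iff₀ (by positivity) (by norm_num)]
      nlinarith
    have h3 : 0 < δ / (4 * (n : ℝ) ^ 2) := by positivity
    have e : δ / (8 * (n : ℝ) ^ 2) = δ / (4 * (n : ℝ) ^ 2) * (1 / 2) := by field_simp; norm_num
    rw [e, pow_succ']
    gcongr
    calc (δ / (4 * (n : ℝ) ^ 2)) ^ 3 ≤ (1 / 4) ^ 3 := by gcongr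
      _ ≤ 1 / 2 := by norm_num
  have hsub : {ω | regretBound 1 C₂ d V n δ - 1 / 2 < regret f A (fun v s => Y v s ω) n} ≤ᵐ[μ]
      (F ∪ D : Set Ω) := by
    filter_upwards [hae] with ω hω hbad
    by_contra hgood
    change ¬ (ω ∈ F ∪ D) at hgood
    simp only [Set.mem_union, not_or] at hgood
    obtain ⟨hgF, hgD⟩ := hgood
    have hfav := not_not.1 hgF
    simp only [D, Set.mem_ofPred_eq, not_le] at hgD
    have hgap := sum_gap_le_of_favourable (A := A) (y := fun v j => Y v j ω)
      (g := fun v => f (P.arm v)) (O := fun v => xs ∈ P.cell v) (fs := ⨆ z, f z) (C := C) (d := d)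
      (ε := ε) (κ := κ) (n := n) (H := H) hb hδ hδ1 rfl (by rw [P.cell_root]; trivial)
      (fun v hv => by rwa [P.cell_split v] at hv)
      (fun v hv hxv => by
        rw [hsup]; exact hsm v (List.length_pos_iff.2 hv) hxv)
      (fun v => by have := (hν.mem_Icc (P.arm v)).1; linarith)
      (fun v T => (empVar_le_sq (fun j => (hω v j).2) T).trans
        (by change (b / 2) ^ 2 ≤ b ^ 2; nlinarith))
      hC hd (nearOptCount_le hC hdim) hn2 hfav hε
      (by
        rw [div_le_iff₀ (by positivity)] at hH0
        change κ ≤ 27 * b * H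
        linarith) hH1
    have hreg : regret f A (fun v s => Y v s ω) n =
        ∑ t ∈ Finset.range n, ((⨆ z, f z) - f (P.arm (pulled A (fun v j => Y v j ω) t))) +
        ∑ t ∈ Finset.range n, (f (P.arm (pulled A (fun v j => Y v j ω) t)) -
          Y (pulled A (fun v j => Y v j ω) t) (pullIdx A (fun v j => Y v j ω) t) ω) := by
      rw [regret_eq, ← Finset.sum_add_distrib]
      exact Finset.sum_congr rfl fun t _ => by ring
    have hmain : ε ^ (1 / (4 * d + 6)) * (n : ℝ) ^ ((2 * d + 2) / (2 * d + 3)) *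
          Real.log (n / δ) ^ (1 / (2 * d + 3)) ≤
        1 * V ^ (1 / (4 * d + 6)) * (n : ℝ) ^ ((2 * d + 2) / (2 * d + 3)) *
          Real.log (n / δ) ^ (1 / (2 * d + 3)) := by
      rw [one_mul]
      gcongr
    have hbad' : regretBound 1 C₂ d V n δ - 1 / 2 < regret f A (fun v s => Y v s ω) n := hbad
    change _ ≤ √(n : ℝ) + 3 * (1 + 94 * b) * (8 * (1 + C) * (Real.log (n / δ) * (H : ℝ) ^ (d + 2)) +
        (2 / ε + 1) * (n / H)) at hgap
    rw [hreg] at hbad'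
    linarith
  calc _ ≤ μ (F ∪ D) := measure_mono_ae hsub
    _ ≤ μ F + μ D := measure_union_le _ _
    _ ≤ ENNReal.ofReal (δ / (8 * (n : ℝ) ^ 2)) + ENNReal.ofReal (δ / (8 * (n : ℝ) ^ 2)) :=
        add_le_add hF hD
    _ = _ := by
        rw [← ENNReal.ofReal_add (by positivity) (by positivity)]
        congr 1
        field_simp
        norm_num

end Main

end VHCT

theorem mainTheorem3
    (C b dbar : ℝ) (hC : 0 < C) (hb : 0 < b) (hd : 0 < dbar) :
    ∃ C₁ : ℝ, 0 < C₁ ∧ ∀ ε : ℝ, 0 < ε → ∃ C₂ : ℝ, 0 < C₂ ∧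
      ∀ (X : Type*) (P : VHCT.HPartition X) (f : X → ℝ) (ν : X → Measure ℝ)
        (Ω : Type*) (_ : MeasurableSpace Ω) (μ : Measure Ω) (_ : IsProbabilityMeasure μ)
        (Y : VHCT.Node → ℕ → Ω → ℝ) (Vmax : ℝ) (tie : ℕ → VHCT.Node → Bool),
        VHCT.LocallySmooth P f (fun h => 1 / (h : ℝ)) →
        VHCT.nearOptDim P f 3 C (fun h => 1 / (h : ℝ)) < ENNReal.ofReal dbar →
        VHCT.IsRewardModel f b ν →
        VHCT.IsRewardSample P ν Y μ →
        (∀ v, ε ≤ variance id (ν (P.arm v)) ∧ variance id (ν (P.arm v)) ≤ Vmax) →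
        (∀ (n : ℕ) (δ : ℝ), 1 ≤ n → 0 < δ → δ ≤ 1 →
          1 - (δ / (4 * (n : ℝ) ^ 2) + δ / (6 * (n : ℝ) ^ 3)) ≤
            μ.real {ω | VHCT.regret f ⟨fun h => 1 / (h : ℝ), b, δ, tie⟩ (fun v s => Y v s ω) n ≤
              VHCT.regretBound C₁ C₂ dbar Vmax n δ}) ∧
        (∀ n : ℕ, 1 ≤ n →
          Integrable (fun ω => VHCT.regret f ⟨fun h => 1 / (h : ℝ), b, 1 / (n : ℝ), tie⟩
            (fun v s => Y v s ω) n) μ ∧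
          ∫ ω, VHCT.regret f ⟨fun h => 1 / (h : ℝ), b, 1 / (n : ℝ), tie⟩
            (fun v s => Y v s ω) n ∂μ ≤
              VHCT.regretBound C₁ C₂ dbar Vmax n (1 / (n : ℝ))) := by
  refine ⟨1, one_pos, fun ε hε => ?_⟩
  obtain ⟨C₂, hC₂, hmain⟩ := VHCT.measure_regret_gt_le hC hb hd hε
  refine ⟨C₂, hC₂, ?_⟩
  intro X P f ν Ω _ μ _ Y Vmax tie hsmooth hdim hν hY hvar
  have hbad := hmain X P f ν Ω _ μ ‹_› Y Vmax tie hsmooth hdim hν hY hvar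
  have hmeas := fun (n : ℕ) (δ : ℝ) => VHCT.measurable_regret f
    ⟨fun h => 1 / (h : ℝ), b, δ, tie⟩ (z := fun ω v s => Y v s ω) hY.measurable n
  refine ⟨fun n δ hn hδ hδ1 => ?_, fun n hn => ?_⟩
  · have h1 := hbad n δ hn hδ hδ1
    have hn0 : (0 : ℝ) < n := by exact_mod_cast hn
    set G := {ω | VHCT.regret f ⟨fun h => 1 / (h : ℝ), b, δ, tie⟩ (fun v s => Y v s ω) n ≤
      VHCT.regretBound 1 C₂ dbar Vmax n δ} with hG
    have hGm : MeasurableSet G := measurableSet_le (hmeas n δ) measurable_const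
    have h2 : μ.real Gᶜ ≤ δ / (4 * (n : ℝ) ^ 2) := by
      refine ENNReal.toReal_le_of_le_ofReal (by positivity) ((measure_mono fun ω hω => ?_).trans h1)
      simp only [hG, Set.mem_compl_iff, Set.mem_ofPred_eq, not_le] at hω ⊢
      linarith
    rw [probReal_compl_eq_one_sub hGm] at h2
    have h3 : 0 ≤ δ / (6 * (n : ℝ) ^ 3) := by positivity
    linarith
  · have hn1 : (1 : ℝ) ≤ n := by exact_mod_cast hn
    have hn0 : (0 : ℝ) < n := by linarith
    have hδ : 0 < 1 / (n : ℝ) := by positivity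
    have hδ1 : 1 / (n : ℝ) ≤ 1 := by rwa [div_le_one hn0]
    obtain ⟨xs, hxs, -⟩ := hsmooth
    have hsup := VHCT.iSup_eq_of_isMax hxs
    have hfs := hν.mem_Icc xs
    rw [← hsup] at hfs
    have hae := hY.ae_all hν
    have hint : Integrable (fun ω => VHCT.regret f ⟨fun h => 1 / (h : ℝ), b, 1 / (n : ℝ), tie⟩
        (fun v s => Y v s ω) n) μ := by
      refine VHCT.integrable_of_abs_le (hmeas n _) (M := n) ?_
      filter_upwards [hae] with ω hω
      exact VHCT.abs_regret_le _ hfs.1 hfs.2 (fun v j => (hω v j).1) n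
    refine ⟨hint, ?_⟩
    set R : Ω → ℝ := fun ω => VHCT.regret f ⟨fun h => 1 / (h : ℝ), b, 1 / (n : ℝ), tie⟩
        (fun v s => Y v s ω) n with hR
    set W := VHCT.regretBound 1 C₂ dbar Vmax n (1 / (n : ℝ)) with hW
    have hεV : ε ≤ Vmax := (hvar []).1.trans (hvar []).2
    have hW0 : 1 / 2 ≤ W := by
      have h1 := (VHCT.regretBound_ge (C₁ := 1) (C₂ := C₂) (d := dbar) (V := Vmax) zero_le_one
        hC₂.le (hε.le.trans hεV) hn hδ hδ1).1
      have h2 := VHCT.sqrt_add_half_le hn hδ hδ1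
      linarith [Real.sqrt_nonneg (n : ℝ)]
    set B : Set Ω := {ω | W - 1 / 2 < R ω} with hB
    have hBm : MeasurableSet B := measurableSet_lt measurable_const (hmeas n _)
    have hBμ : μ.real B ≤ 1 / (n : ℝ) / (4 * (n : ℝ) ^ 2) :=
      ENNReal.toReal_le_of_le_ofReal (by positivity) (hbad n _ hn hδ hδ1)
    calc ∫ ω, R ω ∂μ ≤ ∫ ω, (W - 1 / 2) + B.indicator (fun _ => (n : ℝ)) ω ∂μ := by
          refine integral_mono_ae hint ((integrable_const _).add
            ((integrable_const _).indicator hBm)) ?_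
          filter_upwards [hae] with ω hω
          by_cases h : ω ∈ B
          · have := VHCT.regret_le_card ⟨fun h => 1 / (h : ℝ), b, 1 / (n : ℝ), tie⟩ hfs.2
              (fun v j => (hω v j).1.1) n
            rw [Set.indicator_of_mem h]
            change R ω ≤ n at this
            linarith
          · rw [Set.indicator_of_notMem h, add_zero]
            exact not_lt.1 h
      _ = (W - 1 / 2) + n * μ.real B := by
          rw [integral_add (integrable_const _) ((integrable_const _).indicator hBm),
            integral_indicator hBm]
          simp [mul_comm]
      _ ≤ (W - 1 / 2) + n * (1 / (n : ℝ) / (4 * (n : ℝ) ^ 2)) := by gcongr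
      -- The bad event contributes at most `1 / (4 n ^ 2)`, which fits into the margin `1 / 2`.
      _ ≤ W := by
          have h1 : n * (1 / (n : ℝ) / (4 * (n : ℝ) ^ 2)) = 1 / (4 * (n : ℝ) ^ 2) := by
            field_simp
          have h2 : 1 / (4 * (n : ℝ) ^ 2) ≤ 1 / 2 := by
            apply one_div_le_one_div_of_le (by norm_num)
            nlinarith
          rw [h1]
          linarith
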